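/- Let $w\ge 0$ be a Hölder continuous function on the unit circle $\partial\mathbb D$ with $\frac1{2\pi}\int_0^{2\pi}w(e^{i\theta})\,d\theta=1$, and put $\langle f,g\rangle=\frac1{2\pi}\int_0^{2\pi}f(e^{i\theta})g(e^{i\theta})w(e^{i\theta})\,d\theta$ for real $f,g$. The Gram–Schmidt procedure applied to the ordered system $1,\sin\theta,\cos\theta,\sin2\theta,\cos2\theta,\dots$ gives the "monic" orthogonal functions $1,\,b_1\pi_1,\,a_1\sigma_1,\,b_2\pi_2,\,a_2\sigma_2,\dots$, where for $n\ge1$ the function $b_n\pi_n$ has leading term $\sin n\theta$, $a_n\sigma_n$ has leading term $\cos n\theta$, the numbers $a_n,b_n>0$ are their norms, and $\pi_n,\sigma_n$ are orthonormal. By convention $\sigma_0=1$, $\pi_0=0$, $a_0=\frac12$ and $b_0^{-1}:=0$, $b_0\pi_0:=0$. Put $\beta_0=0$ and, for $n\ge1$, $$\beta_n=\langle\cos n\theta,b_n^{-1}\pi_n\rangle,\quad \imath_n=\langle\cos n\theta,a_{n-1}^{-1}\sigma_{n-1}\rangle,\quad \jmath_n=\langle\cos n\theta,b_{n-1}^{-1}\pi_{n-1}\rangle,$$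 $$\varsigma_n=\langle\sin n\theta,a_{n-1}^{-1}\sigma_{n-1}\rangle,\quad \zeta_n=\langle\sin n\theta,b_{n-1}^{-1}\pi_{n-1}\rangle.$$ For $k\ge0$ let $\lambda_{1,k}=1$, $\lambda_{2,k}=\beta_k+i$, $\lambda_{3,k}=-\frac12a_k^{-2}(1+\beta_ki)$, $\lambda_{4,k}=\frac12b_k^{-2}i$. For fixed $n\ge1$ let $$\triangle_{11}=-\tfrac12(\imath_n+\beta_{n-1}\varsigma_n-\zeta_n)+\tfrac i2(\jmath_n-\imath_n\beta_{n-1}+\varsigma_n),\qquad \triangle_{12}=a_n^2+b_n^2(1+\beta_n^2),$$ $$\triangle_{21}=-\tfrac14\big(a_{n-1}^{-2}(1+\beta_{n-1}^2)+b_{n-1}^{-2}\big),\qquad \triangle_{22}=-\tfrac12(\imath_n+\varsigma_n\beta_{n-1}-\zeta_n)-\tfrac i2(\jmath_n-\imath_n\beta_{n-1}+\varsigma_n).$$ For $f:\partial\mathbb D\to\mathbb C$ and $t\in\partial\mathbb D$ let $$Hf(t)=\mathrm{P.V.}\,\frac1\pi\int_{\partial\mathbb D}\frac{f(\tau)}{t-\tau}\,d\tau=\lim_{\varepsilon\to0^+}\frac1\pi\int_{\tau\in\partial\mathbb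 D,\ |t-\tau|>\varepsilon}\frac{f(\tau)}{t-\tau}\,d\tau .$$ **Theorem 4.10.** Let $n\ge1$. For every $\theta\in[0,2\pi)$, with $\sigma_k(\theta),\pi_k(\theta)$ denoting the values at $e^{i\theta}$: (A) the four-term recurrences $$(\lambda_{1,n}e^{-i\theta}-\overline{\lambda_{1,n}}\triangle_{22})a_n\sigma_n(\theta)+(\lambda_{2,n}e^{-i\theta}-\overline{\lambda_{2,n}}\triangle_{22})b_n\pi_n(\theta)=-\triangle_{12}\big(\overline{\lambda_{3,n-1}}a_{n-1}\sigma_{n-1}(\theta)+\overline{\lambda_{4,n-1}}b_{n-1}\pi_{n-1}(\theta)\big),$$ $$(\lambda_{3,n-1}e^{-i\theta}+\overline{\lambda_{3,n-1}}\triangle_{11})a_{n-1}\sigma_{n-1}(\theta)+(\lambda_{4,n-1}e^{-i\theta}+\overline{\lambda_{4,n-1}}\triangle_{11})b_{n-1}\pi_{n-1}(\theta)=\triangle_{21}\big(\overline{\lambda_{1,n}}a_n\sigma_n(\theta)+\overline{\lambda_{2,n}}b_n\pi_n(\theta)\big)$$ hold; (B) the principal values defining the following Hilbert transforms exist, and $$H[\tau^{-n}(\lambda_{1,n}a_n\sigma_n+\lambda_{2,n}b_n\pi_n)w](e^{i\theta})=e^{-2i(n-1)\theta}\Big[\triangle_{22}H[\tau^{n-1}(\overline{\lambda_{1,n}}a_n\sigma_n+\overline{\lambda_{2,n}}b_n\pi_n)w](e^{i\theta})-\triangle_{12}H[\tau^{n-1}(\overline{\lambda_{3,n-1}}a_{n-1}\sigma_{n-1}+\overline{\lambda_{4,n-1}}b_{n-1}\pi_{n-1})w](e^{i\theta})\Big],$$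 $$H[\tau^{-n}(\lambda_{3,n-1}a_{n-1}\sigma_{n-1}+\lambda_{4,n-1}b_{n-1}\pi_{n-1})w](e^{i\theta})=e^{-2i(n-1)\theta}\Big[\triangle_{21}H[\tau^{n-1}(\overline{\lambda_{1,n}}a_n\sigma_n+\overline{\lambda_{2,n}}b_n\pi_n)w](e^{i\theta})-\triangle_{11}H[\tau^{n-1}(\overline{\lambda_{3,n-1}}a_{n-1}\sigma_{n-1}+\overline{\lambda_{4,n-1}}b_{n-1}\pi_{n-1})w](e^{i\theta})\Big].$$ -/

import Mathlib

open scoped ComplexConjugate Topology NNReal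

namespace OTP

/-- The trigonometric system `1, sin θ, cos θ, …, sin nθ, cos nθ, …` as functions of `τ = e^{iθ}` on
the unit circle: `sin nθ = Im τ^n` has index `2n - 1` and `cos nθ = Re τ^n` has index `2n`. -/
noncomputable def trig (k : ℕ) (τ : Circle) : ℝ :=
  if k % 2 = 0 then ((τ : ℂ) ^ (k / 2)).re else ((τ : ℂ) ^ ((k + 1) / 2)).im

/-- The real inner product `⟨f, g⟩ = ∫ f g dμ` for `dμ = w(τ) dτ / (2πiτ) = w(e^{iθ}) dθ / (2π)`. -/
noncomputable def ip (w f g : Circle → ℝ) : ℝ :=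
  (2 * Real.pi)⁻¹ * ∫ θ in (0 : ℝ)..(2 * Real.pi),
    f (Circle.exp θ) * g (Circle.exp θ) * w (Circle.exp θ)

/-- The "monic" orthogonal functions: the Gram–Schmidt procedure, without normalization, applied to
the ordered trigonometric system. -/
noncomputable def monic (w : Circle → ℝ) (k : ℕ) : Circle → ℝ :=
  trig k - ∑ j : Fin k,
    (ip w (trig k) (monic w j) / ip w (monic w j) (monic w j)) • monic w j
termination_by k
decreasing_by exact j.2

/-- The norm of the `k`-th "monic" orthogonal function. -/
noncomputable def monicNorm (w : Circle → ℝ) (k : ℕ) : ℝ :=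
  Real.sqrt (ip w (monic w k) (monic w k))

/-- `aₙ`, the norm of the function with leading term `cos nθ`. The index `0` is a convention. -/
noncomputable def a (w : Circle → ℝ) : ℕ → ℝ
  | 0 => 1 / 2
  | n + 1 => monicNorm w (2 * (n + 1))

/-- `bₙ`, the norm of the function with leading term `sin nθ`. The value at `0` is a placeholder:
`b₀` occurs only in the product `b₀ π₀`, which is `0`, and through its inverse, and the convention
is that `b₀⁻¹` means `0`. -/
noncomputable def b (w : Circle → ℝ) : ℕ → ℝ
  | 0 => 0
  | n + 1 => monicNorm w (2 * (n + 1) - 1)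

/-- The orthonormal trigonometric polynomial `σₙ` (on the circle), with leading term `cos nθ`;
`σ₀ = 1`. -/
noncomputable def sigma (w : Circle → ℝ) : ℕ → Circle → ℝ
  | 0 => 1
  | n + 1 => (monicNorm w (2 * (n + 1)))⁻¹ • monic w (2 * (n + 1))

/-- The orthonormal trigonometric polynomial `πₙ` (on the circle), with leading term `sin nθ`;
`π₀ = 0`. -/
noncomputable def ppi (w : Circle → ℝ) : ℕ → Circle → ℝ
  | 0 => 0
  | n + 1 => (monicNorm w (2 * (n + 1) - 1))⁻¹ • monic w (2 * (n + 1) - 1)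

/-- `cos nθ` on the circle. -/
noncomputable def cosFn (n : ℕ) (τ : Circle) : ℝ := ((τ : ℂ) ^ n).re

/-- `sin nθ` on the circle. -/
noncomputable def sinFn (n : ℕ) (τ : Circle) : ℝ := ((τ : ℂ) ^ n).im

/-- `βₙ = ⟨cos nθ, bₙ⁻¹ πₙ⟩`; it vanishes for `n = 0`, as `π₀ = 0`. -/
noncomputable def beta (w : Circle → ℝ) (n : ℕ) : ℝ := ip w (cosFn n) ((b w n)⁻¹ • ppi w n)

/-- `ıₙ = ⟨cos nθ, aₙ₋₁⁻¹ σₙ₋₁⟩`, for `n ≥ 1`. -/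
noncomputable def iota (w : Circle → ℝ) (n : ℕ) : ℝ :=
  ip w (cosFn n) ((a w (n - 1))⁻¹ • sigma w (n - 1))

/-- `ȷₙ = ⟨cos nθ, bₙ₋₁⁻¹ πₙ₋₁⟩`, for `n ≥ 1`. -/
noncomputable def jota (w : Circle → ℝ) (n : ℕ) : ℝ :=
  ip w (cosFn n) ((b w (n - 1))⁻¹ • ppi w (n - 1))

/-- `ςₙ = ⟨sin nθ, aₙ₋₁⁻¹ σₙ₋₁⟩`, for `n ≥ 1`. -/
noncomputable def varsigma (w : Circle → ℝ) (n : ℕ) : ℝ :=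
  ip w (sinFn n) ((a w (n - 1))⁻¹ • sigma w (n - 1))

/-- `ζₙ = ⟨sin nθ, bₙ₋₁⁻¹ πₙ₋₁⟩`, for `n ≥ 1`. -/
noncomputable def zeta (w : Circle → ℝ) (n : ℕ) : ℝ :=
  ip w (sinFn n) ((b w (n - 1))⁻¹ • ppi w (n - 1))

/-- `λ₁,ₙ`. -/
noncomputable def lam1 (_w : Circle → ℝ) (_n : ℕ) : ℂ := 1

/-- `λ₂,ₙ`. -/
noncomputable def lam2 (w : Circle → ℝ) (n : ℕ) : ℂ := beta w n + Complex.I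

/-- `λ₃,ₙ`. -/
noncomputable def lam3 (w : Circle → ℝ) (n : ℕ) : ℂ :=
  -(1 / 2) * ((a w n : ℂ)⁻¹) ^ 2 * (1 + beta w n * Complex.I)

/-- `λ₄,ₙ`. -/
noncomputable def lam4 (w : Circle → ℝ) (n : ℕ) : ℂ :=
  (1 / 2) * ((b w n : ℂ)⁻¹) ^ 2 * Complex.I

/-- `△₁₁`, for the index `n ≥ 1`. -/
noncomputable def tri11 (w : Circle → ℝ) (n : ℕ) : ℂ :=
  -(1 / 2) * (iota w n + beta w (n - 1) * varsigma w n - zeta w n)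
    + (Complex.I / 2) * (jota w n - iota w n * beta w (n - 1) + varsigma w n)

/-- `△₁₂`, for the index `n ≥ 1`. -/
noncomputable def tri12 (w : Circle → ℝ) (n : ℕ) : ℂ :=
  (a w n : ℂ) ^ 2 + (b w n : ℂ) ^ 2 * (1 + (beta w n : ℂ) ^ 2)

/-- `△₂₁`, for the index `n ≥ 1`. -/
noncomputable def tri21 (w : Circle → ℝ) (n : ℕ) : ℂ :=
  -(1 / 4) * (((a w (n - 1) : ℂ)⁻¹) ^ 2 * (1 + (beta w (n - 1) : ℂ) ^ 2)
    + ((b w (n - 1) : ℂ)⁻¹) ^ 2)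

/-- `△₂₂`, for the index `n ≥ 1`. -/
noncomputable def tri22 (w : Circle → ℝ) (n : ℕ) : ℂ :=
  -(1 / 2) * (iota w n + varsigma w n * beta w (n - 1) - zeta w n)
    - (Complex.I / 2) * (jota w n - iota w n * beta w (n - 1) + varsigma w n)

/-- The combination `c aₙ σₙ + d bₙ πₙ`. -/
noncomputable def comb (w : Circle → ℝ) (n : ℕ) (c d : ℂ) (τ : Circle) : ℂ :=
  c * a w n * sigma w n τ + d * b w n * ppi w n τ

/-- The truncated integral `(1/π) ∫_{τ ∈ ∂𝔻, |t - τ| > ε} f(τ) / (t - τ) dτ`, where `τ = e^{iθ}` and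
`dτ = i e^{iθ} dθ`. -/
noncomputable def truncatedHilbert (f : Circle → ℂ) (t : Circle) (ε : ℝ) : ℂ :=
  (Real.pi : ℂ)⁻¹ * ∫ θ in (0 : ℝ)..(2 * Real.pi),
    if ε < ‖(t : ℂ) - (Circle.exp θ : ℂ)‖ then
      f (Circle.exp θ) / ((t : ℂ) - (Circle.exp θ : ℂ)) * (Complex.I * (Circle.exp θ : ℂ))
    else 0

/-- The principal value that defines the Hilbert transform of `f` at `t` exists. -/
def HilbertExists (f : Circle → ℂ) (t : Circle) : Prop :=
  ∃ v : ℂ, Filter.Tendsto (truncatedHilbert f t) (𝓝[>] 0) (𝓝 v)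

/-- The Hilbert transform on the unit circle,
`H f(t) = P.V. (1/π) ∫_{∂𝔻} f(τ) / (t - τ) dτ`, meaningful where the principal value exists. -/
noncomputable def hilbert (f : Circle → ℂ) (t : Circle) : ℂ :=
  Filter.limUnder (𝓝[>] 0) (truncatedHilbert f t)

end OTP

namespace OTP

/-! Write L(f) for the integral of f against the weight, extended complex-linearly, and put n = m +
1. The theorem is the Szegő recursion in disguise, for E = `oddCircle w (m + 1)` and D = `evenCircle
w m`.

E = z^(m+1) + △₂₂ z^(-m) + terms of exponents -m+1..m, with L(E z^k) = 0 for |k| ≤ m and L(E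
z^(-m-1)) = △₁₂. D has exponents -m..m, coefficient △₂₁ at z^(-m), L(D z^k) = 0 for -m ≤ k < m, L(D
z^m) = -1 and L(D z^(-m-1)) = △₁₁. On the circle `star` is conjugation and sends z^k to z^(-k).
Hence z⁻¹E - △₂₂ E* + △₁₂ D* and z⁻¹D - △₂₁ E* + △₁₁ D* have exponents in -m..m, the z^(-m-1) terms
cancelling, and are orthogonal to every z^k in that range: only k = -m is not immediate, and there
the constants match. A Laurent polynomial of zero L²-norm for the weight vanishes on the infinite
support of w, so both are zero. These are `zp_mul_oddCircle` and `zp_mul_evenCircle`, and (A) is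
their pointwise form.

For (B), w times a Laurent polynomial is Hölder, so subtracting the value at t leaves an integrable
singularity, and the principal value of the bare kernel is computed by symmetry. Multiply the
recurrence by z^m. Moving the factor τ^(-2m) out of H costs the integral of Q w against (τ^(-2m) -
t^(-2m))/(t - τ) dτ, a Laurent polynomial kernel killed by the orthogonality of E and D
(`hilbert_weighted_zp_mul`). The rest is linearity. -/

/-! ### Laurent polynomials on the circle -/

/-- The monomial `τ ↦ τ ^ k`, as a continuous function on the circle. -/
noncomputable def zp (k : ℤ) : C(Circle, ℂ) :=
  ⟨fun τ => ((τ ^ k : Circle) : ℂ),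
    (show Continuous fun τ : Circle => (τ : ℂ) by fun_prop).comp (continuous_zpow k)⟩

lemma zp_apply (k : ℤ) (τ : Circle) : zp k τ = (τ : ℂ) ^ k := Circle.coe_zpow τ k

lemma zp_zero : zp 0 = 1 := by ext τ; simp [zp_apply]

lemma zp_mul_zp (j k : ℤ) : zp j * zp k = zp (j + k) := by
  ext τ; simp [zp_apply, zpow_add₀]

lemma star_zp (k : ℤ) : star (zp k) = zp (-k) := by
  ext τ
  simp only [ContinuousMap.star_apply, zp, ContinuousMap.coe_mk, zpow_neg, Circle.coe_inv_eq_conj]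
  rfl

/-- The space of Laurent polynomials with exponents between `p` and `q`. -/
noncomputable def laurent (p q : ℤ) : Submodule ℂ C(Circle, ℂ) :=
  Submodule.span ℂ (zp '' Set.Icc p q)

lemma zp_mem {p q k : ℤ} (h₁ : p ≤ k) (h₂ : k ≤ q) : zp k ∈ laurent p q :=
  Submodule.subset_span ⟨k, ⟨h₁, h₂⟩, rfl⟩

lemma laurent_mono {p q p' q' : ℤ} (h₁ : p' ≤ p) (h₂ : q ≤ q') : laurent p q ≤ laurent p' q' :=
  Submodule.span_mono (Set.image_mono (Set.Icc_subset_Icc h₁ h₂))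

lemma zp_mul_mem {p q : ℤ} (j : ℤ) {p' q' : ℤ} {f : C(Circle, ℂ)} (hf : f ∈ laurent p q)
    (hp : p' ≤ j + p) (hq : j + q ≤ q') : zp j * f ∈ laurent p' q' := by
  induction hf using Submodule.span_induction with
  | mem x hx =>
    obtain ⟨k, ⟨h1, h2⟩, rfl⟩ := hx
    rw [zp_mul_zp]
    exact zp_mem (by omega) (by omega)
  | zero => simp
  | add x y _ _ hx hy => rw [mul_add]; exact add_mem hx hy
  | smul c x _ hx => rw [mul_smul_comm]; exact Submodule.smul_mem _ _ hx

lemma star_mem_laurent {p q p' q' : ℤ} {f : C(Circle, ℂ)} (hf : f ∈ laurent p q)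
    (hp : p' ≤ -q) (hq : -p ≤ q') : star f ∈ laurent p' q' := by
  induction hf using Submodule.span_induction with
  | mem x hx =>
    obtain ⟨k, ⟨h1, h2⟩, rfl⟩ := hx
    rw [star_zp]
    exact zp_mem (by omega) (by omega)
  | zero => simp
  | add x y _ _ hx hy => rw [star_add]; exact add_mem hx hy
  | smul c x _ hx => rw [star_smul]; exact Submodule.smul_mem _ _ hx

lemma exists_polynomial_of_mem_laurent {p q : ℤ} {f : C(Circle, ℂ)} (hf : f ∈ laurent p q) :
    ∃ P : Polynomial ℂ, ∀ τ : Circle, f τ = (τ : ℂ) ^ p * P.eval (τ : ℂ) := by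
  induction hf using Submodule.span_induction with
  | mem x hx =>
    obtain ⟨k, ⟨h1, h2⟩, rfl⟩ := hx
    obtain ⟨d, rfl⟩ := Int.le.dest h1
    refine ⟨Polynomial.X ^ d, fun τ => ?_⟩
    simp [zp_apply, zpow_add₀]
  | zero => exact ⟨0, by simp⟩
  | add x y _ _ hx hy =>
    obtain ⟨P, hP⟩ := hx
    obtain ⟨Q, hQ⟩ := hy
    exact ⟨P + Q, fun τ => by simp [hP, hQ, mul_add]⟩
  | smul c x _ hx =>
    obtain ⟨P, hP⟩ := hx
    exact ⟨Polynomial.C c * P, fun τ => by simp [hP]; ring⟩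

/-! ### The integration functional and its nondegeneracy on Laurent polynomials -/

/-- The functional `f ↦ ∫ f dμ` for `dμ = w(e^{iθ}) dθ / (2π)`. -/
noncomputable def Lam (w : C(Circle, ℝ)) : C(Circle, ℂ) →ₗ[ℂ] ℂ where
  toFun f := (2 * Real.pi : ℂ)⁻¹ * ∫ θ in (0 : ℝ)..(2 * Real.pi),
    f (Circle.exp θ) * (w (Circle.exp θ) : ℂ)
  map_add' f g := by
    rw [← mul_add, ← intervalIntegral.integral_add]
    · simp only [ContinuousMap.add_apply, add_mul]
    all_goals exact Continuous.intervalIntegrable (by fun_prop) _ _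
  map_smul' c f := by
    simp only [ContinuousMap.smul_apply, smul_eq_mul, mul_assoc, RingHom.id_apply]
    rw [intervalIntegral.integral_const_mul]
    ring

lemma Lam_apply (w : C(Circle, ℝ)) (f : C(Circle, ℂ)) :
    Lam w f = (2 * Real.pi : ℂ)⁻¹ * ∫ θ in (0 : ℝ)..(2 * Real.pi),
      f (Circle.exp θ) * (w (Circle.exp θ) : ℂ) := rfl

lemma Lam_star (w : C(Circle, ℝ)) (f : C(Circle, ℂ)) : Lam w (star f) = conj (Lam w f) := by
  simp only [Lam_apply, map_mul, intervalIntegral.integral_of_le Real.two_pi_pos.le, ← integral_conj]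
  simp [Complex.conj_ofNat]

lemma Lam_eq_ip (w : C(Circle, ℝ)) {f : C(Circle, ℂ)} {g h : Circle → ℝ}
    (hf : ∀ τ, f τ = (g τ * h τ : ℝ)) : Lam w f = (ip w g h : ℂ) := by
  rw [Lam_apply, ip]
  simp only [hf, ← Complex.ofReal_mul, intervalIntegral.integral_ofReal]
  push_cast
  rfl

lemma Lam_mul_eq_zero (w : C(Circle, ℝ)) {f g : C(Circle, ℂ)} {p q : ℤ} (hf : f ∈ laurent p q)
    (h : ∀ k, p ≤ k → k ≤ q → Lam w (g * zp k) = 0) : Lam w (g * f) = 0 := by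
  induction hf using Submodule.span_induction with
  | mem x hx =>
    obtain ⟨k, ⟨h1, h2⟩, rfl⟩ := hx
    exact h k h1 h2
  | zero => simp
  | add x y _ _ hx hy => rw [mul_add, map_add, hx, hy, add_zero]
  | smul c x _ hx => rw [mul_smul_comm, map_smul, hx, smul_zero]

lemma Lam_one_zp_of_ne {k : ℤ} (hk : k ≠ 0) : Lam 1 (zp k) = 0 := by
  have hc : (k * Complex.I : ℂ) ≠ 0 := by simp [hk]
  have h : ∀ θ : ℝ, zp k (Circle.exp θ) = Complex.exp (k * Complex.I * θ) := by
    intro θ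
    rw [zp_apply, Circle.coe_exp, ← Complex.exp_int_mul]
    ring_nf
  rw [Lam_apply]
  simp only [h, ContinuousMap.one_apply, Complex.ofReal_one, mul_one]
  rw [integral_exp_mul_complex hc]
  have : Complex.exp (k * Complex.I * (2 * Real.pi)) = 1 := by
    rw [← Complex.exp_int_mul_two_pi_mul_I k]
    ring_nf
  simp [this]

lemma Lam_one_zp_zero : Lam 1 (zp 0) = 1 := by
  rw [zp_zero, Lam_apply]
  have : (Real.pi : ℂ) ≠ 0 := by simp [Real.pi_ne_zero]
  simp
  field_simp

/-- For the constant weight 1, pairing with `zp (-k)` reads off the k-th Fourier coefficient, which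
is 0 on the span and 1 on `zp k`. -/
lemma zp_notMem_laurent {p q k : ℤ} (h : ¬ (p ≤ k ∧ k ≤ q)) : zp k ∉ laurent p q := by
  intro hk
  have h0 : Lam 1 (zp (-k) * zp k) = 0 := by
    refine Lam_mul_eq_zero 1 hk fun j h1 h2 => ?_
    rw [zp_mul_zp]
    exact Lam_one_zp_of_ne fun h3 => h (by omega)
  rw [zp_mul_zp, neg_add_cancel, Lam_one_zp_zero] at h0
  exact one_ne_zero h0

/-- The hypotheses on the weight: nonnegative, of total mass one. -/
structure IsWeight (w : C(Circle, ℝ)) : Prop where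
  nonneg : ∀ τ, 0 ≤ w τ
  mass : (2 * Real.pi)⁻¹ * ∫ θ in (0 : ℝ)..(2 * Real.pi), w (Circle.exp θ) = 1

/-- A finite set {w ≠ 0} would be closed as well as open, and nonempty by the mass condition, hence
the whole connected circle, which is infinite. -/
lemma IsWeight.infinite_support {w : C(Circle, ℝ)} (hw : IsWeight w) :
    {τ : Circle | w τ ≠ 0}.Infinite := by
  intro hfin
  have hne : {τ : Circle | w τ ≠ 0}.Nonempty := by
    by_contra hcon
    have h0 : ∀ τ, w τ = 0 := fun τ => by
      by_contra h
      exact hcon ⟨τ, h⟩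
    have := hw.mass
    simp [h0] at this
  have hopen : IsOpen {τ : Circle | w τ ≠ 0} := isOpen_ne_fun w.continuous continuous_const
  have huniv := IsClopen.eq_univ ⟨hfin.isClosed, hopen⟩ hne
  rw [huniv] at hfin
  refine (isPreconnected_univ (α := Circle)).infinite_of_nontrivial
    ⟨1, trivial, Circle.exp Real.pi, trivial, fun h => ?_⟩ hfin
  have := congrArg (fun τ : Circle => (τ : ℂ)) h
  simp at this
  norm_num [Complex.ext_iff] at this

lemma IsWeight.mul_weight_eq_zero {w : C(Circle, ℝ)} (hw : IsWeight w) {f : C(Circle, ℂ)}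
    (hf : Lam w (f * star f) = 0) (τ : Circle) : f τ = 0 ∨ w τ = 0 := by
  by_contra! hcon
  obtain ⟨θ, hθ, rfl⟩ : ∃ θ ∈ Set.Ico (0 : ℝ) (2 * Real.pi), Circle.exp θ = τ := by
    obtain ⟨θ, rfl⟩ := Circle.exp_surjective τ
    obtain ⟨y, hy, h⟩ := Circle.periodic_exp.exists_mem_Ico₀ Real.two_pi_pos θ
    exact ⟨y, hy, h.symm⟩
  have hpos : 0 < ∫ θ in (0 : ℝ)..(2 * Real.pi),
      Complex.normSq (f (Circle.exp θ)) * w (Circle.exp θ) := by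
    refine intervalIntegral.integral_pos Real.two_pi_pos ?_ ?_ ⟨θ, Set.Ico_subset_Icc_self hθ, ?_⟩
    · exact Continuous.continuousOn
        ((Complex.continuous_normSq.comp (by fun_prop)).mul (by fun_prop))
    · exact fun x _ => mul_nonneg (Complex.normSq_nonneg _) (hw.nonneg _)
    · exact mul_pos (Complex.normSq_pos.2 hcon.1) ((hw.nonneg _).lt_of_ne' hcon.2)
  have hval : Lam w (f * star f) = (((2 * Real.pi)⁻¹ * ∫ θ in (0 : ℝ)..(2 * Real.pi),
      Complex.normSq (f (Circle.exp θ)) * w (Circle.exp θ) : ℝ) : ℂ) := by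
    rw [Lam_apply]
    push_cast
    rw [← intervalIntegral.integral_ofReal]
    simp [← Complex.mul_conj]
  rw [hval, Complex.ofReal_eq_zero] at hf
  exact (mul_pos (inv_pos.2 Real.two_pi_pos) hpos).ne' hf

/-- The weight may vanish on arcs, so positivity only gives f = 0 where w ≠ 0; this is still
infinitely many roots of the polynomial z^(-p) f. -/
lemma IsWeight.eq_zero_of_Lam_mul_star {w : C(Circle, ℝ)} (hw : IsWeight w) {f : C(Circle, ℂ)}
    {p q : ℤ} (hfm : f ∈ laurent p q) (hf : Lam w (f * star f) = 0) : f = 0 := by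
  obtain ⟨P, hP⟩ := exists_polynomial_of_mem_laurent hfm
  have hP0 : P = 0 := by
    refine Polynomial.eq_zero_of_infinite_isRoot P
      ((hw.infinite_support.image Circle.coe_injective.injOn).mono ?_)
    refine Set.image_subset_iff.2 fun (τ : Circle) hτ => ?_
    have h := (hw.mul_weight_eq_zero hf τ).resolve_right hτ
    rw [hP] at h
    exact (mul_eq_zero.1 h).resolve_left (zpow_ne_zero _ τ.coe_ne_zero)
  ext τ
  simp [hP, hP0]

/-- A Laurent polynomial orthogonal to all monomials of its own span vanishes. -/
lemma IsWeight.eq_zero_of_orthogonal {w : C(Circle, ℝ)} (hw : IsWeight w) {f : C(Circle, ℂ)}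
    {m : ℤ} (hfm : f ∈ laurent (-m) m)
    (hf : ∀ k, -m ≤ k → k ≤ m → Lam w (f * zp k) = 0) : f = 0 :=
  hw.eq_zero_of_Lam_mul_star hfm
    (Lam_mul_eq_zero w (star_mem_laurent hfm le_rfl (by simp)) hf)

/-! ### The Gram–Schmidt functions as Laurent polynomials -/

/-- The trigonometric system as complex-valued continuous functions. -/
noncomputable def trigC (k : ℕ) : C(Circle, ℂ) :=
  if k % 2 = 0 then (1 / 2 : ℂ) • (zp (k / 2 : ℕ) + zp (-(k / 2 : ℕ)))
  else (-Complex.I / 2) • (zp ((k + 1) / 2 : ℕ) - zp (-((k + 1) / 2 : ℕ)))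

lemma trigC_apply (k : ℕ) (τ : Circle) : trigC k τ = (trig k τ : ℂ) := by
  have h : ∀ n : ℕ, zp (-n) τ = conj ((τ : ℂ) ^ n) := fun n => by
    rw [← star_zp, ContinuousMap.star_apply, zp_apply, zpow_natCast]
    rfl
  unfold trigC trig
  split_ifs
  · rw [ContinuousMap.smul_apply, ContinuousMap.add_apply, h, zp_apply, zpow_natCast,
      Complex.add_conj, smul_eq_mul]
    push_cast
    ring
  · rw [ContinuousMap.smul_apply, ContinuousMap.sub_apply, h, zp_apply, zpow_natCast,
      Complex.sub_conj, smul_eq_mul]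
    push_cast
    linear_combination (-(((τ : ℂ) ^ ((k + 1) / 2)).im : ℂ)) * Complex.I_mul_I

lemma trigC_even (n : ℕ) : trigC (2 * n) = (1 / 2 : ℂ) • (zp n + zp (-n)) := by
  have h : 2 * n / 2 = n := by omega
  simp [trigC, h]

lemma trigC_odd (n : ℕ) :
    trigC (2 * n + 1) = (-Complex.I / 2) • (zp (n + 1) - zp (-(n + 1))) := by
  have h : (2 * n + 1 + 1) / 2 = n + 1 := by omega
  have h' : ¬ (2 * n + 1) % 2 = 0 := by omega
  simp only [trigC, h, h', if_false]
  push_cast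
  rfl

lemma trigC_mem {k : ℕ} {m : ℤ} (h : (k : ℤ) ≤ 2 * m) : trigC k ∈ laurent (-m) m := by
  unfold trigC
  split_ifs
  · exact Submodule.smul_mem _ _ (add_mem (zp_mem (by omega) (by omega))
      (zp_mem (by omega) (by omega)))
  · exact Submodule.smul_mem _ _ (sub_mem (zp_mem (by omega) (by omega))
      (zp_mem (by omega) (by omega)))

lemma star_eq_self_of_real {f : C(Circle, ℂ)} {g : Circle → ℝ} (h : ∀ τ, f τ = (g τ : ℂ)) :
    star f = f := by
  ext τ
  rw [ContinuousMap.star_apply, h]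
  exact Complex.conj_ofReal _

/-- The Fourier coefficient of the `k`-th trigonometric function along the `j`-th orthogonal one. -/
noncomputable def coef (w : Circle → ℝ) (k j : ℕ) : ℝ :=
  ip w (trig k) (monic w j) / ip w (monic w j) (monic w j)

lemma monic_eq (w : Circle → ℝ) (k : ℕ) :
    monic w k = trig k - ∑ j ∈ Finset.range k, coef w k j • monic w j := by
  rw [monic, Finset.sum_range]
  rfl

/-- The monic orthogonal functions as complex-valued continuous functions. -/
noncomputable def cmon (w : C(Circle, ℝ)) (k : ℕ) : C(Circle, ℂ) :=
  trigC k - ∑ j : Fin k, (coef w k j : ℂ) • cmon w j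
termination_by k
decreasing_by exact j.2

lemma cmon_eq (w : C(Circle, ℝ)) (k : ℕ) :
    cmon w k = trigC k - ∑ j ∈ Finset.range k, (coef w k j : ℂ) • cmon w j := by
  rw [cmon, Finset.sum_range]

lemma cmon_apply (w : C(Circle, ℝ)) (k : ℕ) (τ : Circle) : cmon w k τ = (monic w k τ : ℂ) := by
  induction k using Nat.strong_induction_on with
  | _ k ih =>
    rw [cmon_eq, monic_eq, ContinuousMap.sub_apply, ContinuousMap.sum_apply, trigC_apply,
      Pi.sub_apply, Finset.sum_apply, Complex.ofReal_sub, Complex.ofReal_sum]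
    congr 1
    refine Finset.sum_congr rfl fun j hj => ?_
    simp [ih j (Finset.mem_range.1 hj)]

lemma star_cmon (w : C(Circle, ℝ)) (k : ℕ) : star (cmon w k) = cmon w k :=
  star_eq_self_of_real (cmon_apply w k)

lemma cmon_mem (w : C(Circle, ℝ)) {k : ℕ} {m : ℤ} (h : (k : ℤ) ≤ 2 * m) :
    cmon w k ∈ laurent (-m) m := by
  induction k using Nat.strong_induction_on with
  | _ k ih =>
    rw [cmon_eq]
    refine sub_mem (trigC_mem h) (sum_mem fun j hj => Submodule.smul_mem _ _ ?_)
    have := Finset.mem_range.1 hj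
    exact ih j this (by omega)

lemma sum_cmon_mem (w : C(Circle, ℝ)) {k : ℕ} {p q : ℤ} (c : ℕ → ℂ) {m : ℤ}
    (h : (k : ℤ) ≤ 2 * m + 1) (hp : p ≤ -m) (hq : m ≤ q) :
    ∑ j ∈ Finset.range k, c j • cmon w j ∈ laurent p q := by
  refine sum_mem fun j hj => Submodule.smul_mem _ _ ?_
  have := Finset.mem_range.1 hj
  exact laurent_mono hp hq (cmon_mem w (by omega))

/-- Isolates the lowest coefficient: all earlier functions have frequency at most m, so z^(-m-1)
arises only from sin (m+1)θ, with coefficient i/2. -/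
lemma cmon_odd_sub_mem (w : C(Circle, ℝ)) (m : ℕ) :
    cmon w (2 * m + 1) - (Complex.I / 2) • zp (-(m + 1)) ∈ laurent (-m) (m + 1) := by
  have h : cmon w (2 * m + 1) - (Complex.I / 2) • zp (-(m + 1)) =
      (-Complex.I / 2) • zp (m + 1)
        - ∑ j ∈ Finset.range (2 * m + 1), (coef w (2 * m + 1) j : ℂ) • cmon w j := by
    rw [cmon_eq, trigC_odd]
    module
  rw [h]
  exact sub_mem (Submodule.smul_mem _ _ (zp_mem (by omega) (by omega)))
    (sum_cmon_mem w _ (m := m) (by omega) (by omega) (by omega))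

/-- Here z^(-m-1) receives 1/2 from cos (m+1)θ, and -i/2 times the Gram–Schmidt coefficient from the
subtracted sine function of the same frequency. -/
lemma cmon_even_sub_mem (w : C(Circle, ℝ)) (m : ℕ) :
    cmon w (2 * m + 2) - ((1 - Complex.I * coef w (2 * m + 2) (2 * m + 1)) / 2 : ℂ) •
      zp (-(m + 1)) ∈ laurent (-m) (m + 1) := by
  have h : cmon w (2 * m + 2) - ((1 - Complex.I * coef w (2 * m + 2) (2 * m + 1)) / 2 : ℂ) •
      zp (-(m + 1)) = (1 / 2 : ℂ) • zp (m + 1)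
        - (coef w (2 * m + 2) (2 * m + 1) : ℂ) •
          (cmon w (2 * m + 1) - (Complex.I / 2) • zp (-(m + 1)))
        - ∑ j ∈ Finset.range (2 * m + 1), (coef w (2 * m + 2) j : ℂ) • cmon w j := by
    rw [cmon_eq w (2 * m + 2), Finset.sum_range_succ, show 2 * m + 2 = 2 * (m + 1) by ring,
      trigC_even]
    push_cast
    module
  rw [h]
  exact sub_mem (sub_mem (Submodule.smul_mem _ _ (zp_mem (by omega) (by omega)))
    (Submodule.smul_mem _ _ (cmon_odd_sub_mem w m)))
    (sum_cmon_mem w _ (m := m) (by omega) (by omega) (by omega))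

lemma ne_zero_of_sub_mem {f : C(Circle, ℂ)} {c : ℂ} {p q k : ℤ} (hc : c ≠ 0)
    (hk : ¬ (p ≤ k ∧ k ≤ q)) (h : f - c • zp k ∈ laurent p q) : f ≠ 0 := by
  rintro rfl
  rw [zero_sub, neg_mem_iff, Submodule.smul_mem_iff _ hc] at h
  exact zp_notMem_laurent hk h

lemma cmon_zero (w : C(Circle, ℝ)) : cmon w 0 = 1 := by
  have := trigC_even 0
  rw [cmon_eq, Finset.sum_range_zero, sub_zero, ← mul_zero 2, this]
  simp only [Nat.cast_zero, neg_zero, zp_zero]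
  module

lemma cmon_ne_zero (w : C(Circle, ℝ)) (k : ℕ) : cmon w k ≠ 0 := by
  obtain ⟨m, rfl | rfl⟩ : ∃ m, k = 2 * m ∨ k = 2 * m + 1 := ⟨k / 2, by omega⟩
  · cases m with
    | zero => rw [mul_zero, cmon_zero]; exact one_ne_zero
    | succ m =>
      refine ne_zero_of_sub_mem ?_ (by omega) (cmon_even_sub_mem w m)
      intro h
      have := congrArg Complex.re h
      norm_num at this
  · exact ne_zero_of_sub_mem (by simp) (by omega) (cmon_odd_sub_mem w m)

/-! ### Orthogonality relations -/

lemma Lam_trigC_mul_cmon (w : C(Circle, ℝ)) (k j : ℕ) :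
    Lam w (trigC k * cmon w j) = (ip w (trig k) (monic w j) : ℂ) :=
  Lam_eq_ip w fun τ => by simp [trigC_apply, cmon_apply]

lemma Lam_cmon_mul_cmon (w : C(Circle, ℝ)) (k j : ℕ) :
    Lam w (cmon w k * cmon w j) = (ip w (monic w k) (monic w j) : ℂ) :=
  Lam_eq_ip w fun τ => by simp [cmon_apply]

variable {w : C(Circle, ℝ)}

lemma IsWeight.ip_monic_ne_zero (hw : IsWeight w) (k : ℕ) :
    ip w (monic w k) (monic w k) ≠ 0 := by
  intro h
  refine cmon_ne_zero w k (hw.eq_zero_of_Lam_mul_star (cmon_mem w (m := k) (by omega)) ?_)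
  rw [star_cmon, Lam_cmon_mul_cmon, h, Complex.ofReal_zero]

lemma IsWeight.ip_monic_pos (hw : IsWeight w) (k : ℕ) : 0 < ip w (monic w k) (monic w k) := by
  refine lt_of_le_of_ne' (mul_nonneg (inv_nonneg.2 Real.two_pi_pos.le) ?_) (hw.ip_monic_ne_zero k)
  exact intervalIntegral.integral_nonneg Real.two_pi_pos.le
    fun θ _ => mul_nonneg (mul_self_nonneg _) (hw.nonneg _)

lemma IsWeight.Lam_cmon_mul_cmon_of_lt (hw : IsWeight w) {j k : ℕ} (h : j < k) :
    Lam w (cmon w k * cmon w j) = 0 := by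
  induction k using Nat.strong_induction_on generalizing j with
  | _ k ih =>
    rw [cmon_eq w k, sub_mul, map_sub, Finset.sum_mul, map_sum, Finset.sum_eq_single j,
      smul_mul_assoc, map_smul, Lam_cmon_mul_cmon, Lam_trigC_mul_cmon, coef, smul_eq_mul,
      ← Complex.ofReal_mul, div_mul_cancel₀ _ (hw.ip_monic_ne_zero j), sub_self]
    · intro i hi hij
      have hik := Finset.mem_range.1 hi
      rw [smul_mul_assoc, map_smul]
      rcases lt_or_gt_of_ne hij with h1 | h1
      · rw [mul_comm, ih j h h1, smul_zero]
      · rw [ih i hik h1, smul_zero]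
    · intro h1
      exact absurd (Finset.mem_range.2 h) h1

lemma IsWeight.Lam_cmon_mul_trigC_of_lt (hw : IsWeight w) {j k : ℕ} (h : j < k) :
    Lam w (cmon w k * trigC j) = 0 := by
  rw [← sub_add_cancel (trigC j) (∑ i ∈ Finset.range j, (coef w j i : ℂ) • cmon w i), ← cmon_eq,
    mul_add, map_add, hw.Lam_cmon_mul_cmon_of_lt h, zero_add, Finset.mul_sum, map_sum]
  refine Finset.sum_eq_zero fun i hi => ?_
  rw [mul_smul_comm, map_smul, hw.Lam_cmon_mul_cmon_of_lt ((Finset.mem_range.1 hi).trans h),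
    smul_zero]

lemma IsWeight.Lam_cmon_mul_trigC (hw : IsWeight w) (j k : ℕ) :
    Lam w (cmon w k * trigC j) = (coef w j k : ℂ) * (ip w (monic w k) (monic w k) : ℂ) := by
  rw [mul_comm, Lam_trigC_mul_cmon, ← Complex.ofReal_mul, coef,
    div_mul_cancel₀ _ (hw.ip_monic_ne_zero k)]

lemma IsWeight.Lam_cmon_mul_trigC_self (hw : IsWeight w) (k : ℕ) :
    Lam w (cmon w k * trigC k) = (ip w (monic w k) (monic w k) : ℂ) := by
  rw [← sub_add_cancel (trigC k) (∑ i ∈ Finset.range k, (coef w k i : ℂ) • cmon w i), ← cmon_eq,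
    mul_add, map_add, Lam_cmon_mul_cmon, Finset.mul_sum, map_sum, Finset.sum_eq_zero, add_zero]
  intro i hi
  rw [mul_smul_comm, map_smul, hw.Lam_cmon_mul_cmon_of_lt (Finset.mem_range.1 hi), smul_zero]

lemma zp_eq_trigC (m : ℕ) : zp (m + 1) = trigC (2 * m + 2) + Complex.I • trigC (2 * m + 1) := by
  rw [show 2 * m + 2 = 2 * (m + 1) by ring, trigC_even, trigC_odd, smul_smul]
  have : Complex.I * (-Complex.I / 2) = 1 / 2 := by
    linear_combination (-1 / 2 : ℂ) * Complex.I_mul_I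
  rw [this]
  push_cast
  module

lemma zp_neg_eq_trigC (m : ℕ) :
    zp (-(m + 1)) = trigC (2 * m + 2) - Complex.I • trigC (2 * m + 1) := by
  rw [show 2 * m + 2 = 2 * (m + 1) by ring, trigC_even, trigC_odd, smul_smul]
  have : Complex.I * (-Complex.I / 2) = 1 / 2 := by
    linear_combination (-1 / 2 : ℂ) * Complex.I_mul_I
  rw [this]
  push_cast
  module

lemma trigC_zero : trigC 0 = 1 := by
  rw [← cmon_zero 1, cmon_eq, Finset.sum_range_zero, sub_zero]

/-- The monomials of exponents -m..m are combinations of the trigonometric functions of index at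
most 2m, all preceding k. -/
lemma IsWeight.Lam_cmon_mul_of_mem (hw : IsWeight w) {k : ℕ} {m : ℤ} (h : 2 * m < k)
    {f : C(Circle, ℂ)} (hf : f ∈ laurent (-m) m) : Lam w (cmon w k * f) = 0 := by
  refine Lam_mul_eq_zero w hf fun i h1 h2 => ?_
  obtain ⟨j, rfl | rfl⟩ := i.eq_nat_or_neg
  · cases j with
    | zero =>
      rw [Nat.cast_zero, zp_zero, ← trigC_zero]
      exact hw.Lam_cmon_mul_trigC_of_lt (by omega)
    | succ j =>
      push_cast at h2 ⊢
      rw [zp_eq_trigC, mul_add, mul_smul_comm, map_add, map_smul,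
        hw.Lam_cmon_mul_trigC_of_lt (by omega), hw.Lam_cmon_mul_trigC_of_lt (by omega)]
      simp
  · cases j with
    | zero =>
      rw [Nat.cast_zero, neg_zero, zp_zero, ← trigC_zero]
      exact hw.Lam_cmon_mul_trigC_of_lt (by omega)
    | succ j =>
      push_cast at h1 ⊢
      rw [zp_neg_eq_trigC, mul_sub, mul_smul_comm, map_sub, map_smul,
        hw.Lam_cmon_mul_trigC_of_lt (by omega), hw.Lam_cmon_mul_trigC_of_lt (by omega)]
      simp

/-! ### The recurrence constants as Gram–Schmidt coefficients -/

lemma cosFn_succ (m : ℕ) : cosFn (m + 1) = trig (2 * m + 2) := by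
  funext τ
  rw [cosFn, trig, if_pos (by omega), show (2 * m + 2) / 2 = m + 1 by omega]

lemma sinFn_succ (m : ℕ) : sinFn (m + 1) = trig (2 * m + 1) := by
  funext τ
  rw [sinFn, trig, if_neg (by omega), show (2 * m + 1 + 1) / 2 = m + 1 by omega]

lemma ip_smul_right (w f g : Circle → ℝ) (c : ℝ) : ip w f (c • g) = c * ip w f g := by
  simp only [ip, Pi.smul_apply, smul_eq_mul]
  rw [mul_left_comm, ← intervalIntegral.integral_const_mul c]
  congr 2
  funext θ
  ring

/-- One inverse norm comes from the orthonormal function, the other from the factor `a⁻¹` or `b⁻¹`;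
together they form the Gram–Schmidt denominator. -/
lemma ip_monicNorm_inv (w f : Circle → ℝ) (k : ℕ) (h : 0 ≤ ip w (monic w k) (monic w k)) :
    ip w f ((monicNorm w k)⁻¹ • (monicNorm w k)⁻¹ • monic w k) =
      ip w f (monic w k) / ip w (monic w k) (monic w k) := by
  rw [smul_smul, ip_smul_right, ← mul_inv, monicNorm, Real.mul_self_sqrt h, inv_mul_eq_div]

lemma IsWeight.beta_succ (hw : IsWeight w) (m : ℕ) :
    beta w (m + 1) = coef w (2 * m + 2) (2 * m + 1) := by
  rw [beta, cosFn_succ]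
  exact ip_monicNorm_inv _ _ _ (hw.ip_monic_pos _).le

lemma beta_zero (w : Circle → ℝ) : beta w 0 = 0 := by
  simp [beta, ppi, ip]

lemma IsWeight.iota_succ_succ (hw : IsWeight w) (p : ℕ) :
    iota w (p + 1 + 1) = coef w (2 * (p + 1) + 2) (2 * p + 2) := by
  rw [iota, cosFn_succ]
  exact ip_monicNorm_inv _ _ _ (hw.ip_monic_pos _).le

lemma IsWeight.jota_succ_succ (hw : IsWeight w) (p : ℕ) :
    jota w (p + 1 + 1) = coef w (2 * (p + 1) + 2) (2 * p + 1) := by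
  rw [jota, cosFn_succ]
  exact ip_monicNorm_inv _ _ _ (hw.ip_monic_pos _).le

lemma IsWeight.varsigma_succ_succ (hw : IsWeight w) (p : ℕ) :
    varsigma w (p + 1 + 1) = coef w (2 * (p + 1) + 1) (2 * p + 2) := by
  rw [varsigma, sinFn_succ]
  exact ip_monicNorm_inv _ _ _ (hw.ip_monic_pos _).le

lemma IsWeight.zeta_succ_succ (hw : IsWeight w) (p : ℕ) :
    zeta w (p + 1 + 1) = coef w (2 * (p + 1) + 1) (2 * p + 1) := by
  rw [zeta, sinFn_succ]
  exact ip_monicNorm_inv _ _ _ (hw.ip_monic_pos _).le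

lemma monic_zero (w : Circle → ℝ) : monic w 0 = 1 := by
  rw [monic_eq]
  funext τ
  simp [trig]

lemma IsWeight.ip_monic_zero (hw : IsWeight w) : ip w (monic w 0) (monic w 0) = 1 := by
  rw [monic_zero, ← hw.mass]
  simp [ip]

/-- The factor 2 is `a₀⁻¹` under the convention `a₀ = 1/2`, which is not the norm of the constant
function 1. -/
lemma IsWeight.iota_one (hw : IsWeight w) : iota w 1 = 2 * coef w 2 0 := by
  rw [iota, coef, hw.ip_monic_zero, monic_zero, cosFn_succ 0, ip_smul_right]
  simp [a, sigma]

lemma IsWeight.varsigma_one (hw : IsWeight w) : varsigma w 1 = 2 * coef w 1 0 := by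
  rw [varsigma, coef, hw.ip_monic_zero, monic_zero, sinFn_succ 0, ip_smul_right]
  simp [a, sigma]

lemma jota_one (w : Circle → ℝ) : jota w 1 = 0 := by
  simp [jota, ppi, ip]

lemma zeta_one (w : Circle → ℝ) : zeta w 1 = 0 := by
  simp [zeta, ppi, ip]

lemma IsWeight.sq_a_succ (hw : IsWeight w) (m : ℕ) :
    a w (m + 1) ^ 2 = ip w (monic w (2 * m + 2)) (monic w (2 * m + 2)) :=
  Real.sq_sqrt (hw.ip_monic_pos _).le

lemma IsWeight.sq_b_succ (hw : IsWeight w) (m : ℕ) :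
    b w (m + 1) ^ 2 = ip w (monic w (2 * m + 1)) (monic w (2 * m + 1)) :=
  Real.sq_sqrt (hw.ip_monic_pos _).le

lemma IsWeight.a_succ_mul_sigma (hw : IsWeight w) (m : ℕ) (τ : Circle) :
    a w (m + 1) * sigma w (m + 1) τ = monic w (2 * m + 2) τ :=
  mul_inv_cancel_left₀ (Real.sqrt_pos.2 (hw.ip_monic_pos _)).ne' _

lemma IsWeight.b_succ_mul_ppi (hw : IsWeight w) (m : ℕ) (τ : Circle) :
    b w (m + 1) * ppi w (m + 1) τ = monic w (2 * m + 1) τ :=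
  mul_inv_cancel_left₀ (Real.sqrt_pos.2 (hw.ip_monic_pos _)).ne' _

/-! ### The two circle functions: extreme coefficients and pairings -/

/-- The function `aₙ σₙ`, complex-valued. -/
noncomputable def cosPart (w : C(Circle, ℝ)) : ℕ → C(Circle, ℂ)
  | 0 => (1 / 2 : ℂ) • 1
  | m + 1 => cmon w (2 * m + 2)

/-- The function `bₙ πₙ`, complex-valued. -/
noncomputable def sinPart (w : C(Circle, ℝ)) : ℕ → C(Circle, ℂ)
  | 0 => 0
  | m + 1 => cmon w (2 * m + 1)

/-- The combination `c aₙ σₙ + d bₙ πₙ` as a continuous function. -/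
noncomputable def combC (w : C(Circle, ℝ)) (n : ℕ) (c d : ℂ) : C(Circle, ℂ) :=
  c • cosPart w n + d • sinPart w n

lemma IsWeight.combC_apply (hw : IsWeight w) (n : ℕ) (c d : ℂ) (τ : Circle) :
    combC w n c d τ = comb w n c d τ := by
  rw [comb, mul_assoc, mul_assoc, ← Complex.ofReal_mul, ← Complex.ofReal_mul]
  cases n with
  | zero => simp [combC, cosPart, sinPart, a, sigma, ppi]
  | succ m =>
    rw [hw.a_succ_mul_sigma, hw.b_succ_mul_ppi, ← cmon_apply, ← cmon_apply]
    rfl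

lemma star_combC (n : ℕ) (c d : ℂ) : star (combC w n c d) = combC w n (conj c) (conj d) := by
  have h1 : star (cosPart w n) = cosPart w n := by
    cases n with
    | zero => simp [cosPart, star_smul]
    | succ m => exact star_cmon w _
  have h2 : star (sinPart w n) = sinPart w n := by
    cases n with
    | zero => simp [sinPart]
    | succ m => exact star_cmon w _
  rw [combC, star_add, star_smul, star_smul, h1, h2]
  rfl

lemma combC_mem (w : C(Circle, ℝ)) (n : ℕ) (c d : ℂ) : combC w n c d ∈ laurent (-n) n := by
  refine add_mem (Submodule.smul_mem _ _ ?_) (Submodule.smul_mem _ _ ?_)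
  · cases n with
    | zero => exact Submodule.smul_mem _ _ (zp_zero ▸ zp_mem (by simp) (by simp))
    | succ m => exact cmon_mem w (by push_cast; omega)
  · cases n with
    | zero => exact zero_mem _
    | succ m => exact cmon_mem w (by push_cast; omega)

/-- The function `λ₁ aₙ σₙ + λ₂ bₙ πₙ`: up to a power of `τ`, the monic orthogonal polynomial on the
unit circle of degree `2n - 1`. -/
noncomputable def oddCircle (w : C(Circle, ℝ)) (n : ℕ) : C(Circle, ℂ) :=
  combC w n (lam1 w n) (lam2 w n)

/-- The function `λ₃ aₙ σₙ + λ₄ bₙ πₙ`: up to a power of `τ` and a constant, the reversed orthogonal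
polynomial on the unit circle of degree `2n`. -/
noncomputable def evenCircle (w : C(Circle, ℝ)) (n : ℕ) : C(Circle, ℂ) :=
  combC w n (lam3 w n) (lam4 w n)

lemma IsWeight.oddCircle_succ (hw : IsWeight w) (m : ℕ) :
    oddCircle w (m + 1) = cmon w (2 * m + 2) +
      ((coef w (2 * m + 2) (2 * m + 1) : ℂ) + Complex.I) • cmon w (2 * m + 1) := by
  rw [oddCircle, combC, lam1, lam2, hw.beta_succ, one_smul]
  rfl

lemma IsWeight.Lam_oddCircle_mul (hw : IsWeight w) (m : ℕ) {f : C(Circle, ℂ)}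
    (hf : f ∈ laurent (-m) m) : Lam w (oddCircle w (m + 1) * f) = 0 := by
  rw [hw.oddCircle_succ, add_mul, smul_mul_assoc, map_add, map_smul,
    hw.Lam_cmon_mul_of_mem (by omega) hf, hw.Lam_cmon_mul_of_mem (by omega) hf, smul_zero, add_zero]

lemma IsWeight.Lam_oddCircle_mul_zp_neg (hw : IsWeight w) (m : ℕ) :
    Lam w (oddCircle w (m + 1) * zp (-(m + 1))) = tri12 w (m + 1) := by
  rw [hw.oddCircle_succ, zp_neg_eq_trigC, tri12, ← Complex.ofReal_pow, ← Complex.ofReal_pow,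
    hw.sq_a_succ, hw.sq_b_succ, hw.beta_succ]
  simp only [add_mul, mul_sub, smul_mul_assoc, mul_smul_comm, map_add, map_sub, map_smul,
    hw.Lam_cmon_mul_trigC_self, hw.Lam_cmon_mul_trigC_of_lt (Nat.lt_succ_self (2 * m + 1)),
    hw.Lam_cmon_mul_trigC (2 * m + 2) (2 * m + 1), smul_eq_mul]
  linear_combination (-(ip w (monic w (2 * m + 1)) (monic w (2 * m + 1)) : ℂ)) * Complex.I_mul_I

/-- Adding β times the sine function restores exactly what Gram–Schmidt removed from the cosine;
what remains is cos + i sin, corrected by functions of lower frequency only. -/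
lemma IsWeight.oddCircle_eq (hw : IsWeight w) (m : ℕ) :
    oddCircle w (m + 1) = zp (m + 1) - ∑ j ∈ Finset.range (2 * m + 1),
      ((coef w (2 * m + 2) j : ℂ) + Complex.I * coef w (2 * m + 1) j) • cmon w j := by
  have h1 := cmon_eq w (2 * m + 2)
  rw [Finset.sum_range_succ] at h1
  have h2 := cmon_eq w (2 * m + 1)
  rw [hw.oddCircle_succ, add_smul, h1, zp_eq_trigC]
  -- Only the copy multiplied by i is expanded; the two copies multiplied by β cancel.
  nth_rewrite 3 [h2]
  simp only [add_smul, Finset.sum_add_distrib, ← smul_smul, ← Finset.smul_sum]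
  module

lemma IsWeight.oddCircle_sub_mem (hw : IsWeight w) (m : ℕ) :
    oddCircle w (m + 1) - zp (m + 1) - tri22 w (m + 1) • zp (-m) ∈ laurent (-m + 1) m := by
  rw [hw.oddCircle_eq]
  cases m with
  | zero =>
    have h : tri22 w (0 + 1) = -((coef w 2 0 : ℂ) + Complex.I * coef w 1 0) := by
      rw [tri22, zero_add, hw.iota_one, hw.varsigma_one, jota_one, zeta_one, beta_zero]
      push_cast
      ring
    rw [h, mul_zero, zero_add, Finset.sum_range_one, cmon_zero]
    convert Submodule.zero_mem _
    rw [Nat.cast_zero, neg_zero, zp_zero]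
    module
  | succ p =>
    have h : tri22 w (p + 1 + 1) =
        -(((coef w (2 * (p + 1) + 2) (2 * p + 1) : ℂ)
          + Complex.I * coef w (2 * (p + 1) + 1) (2 * p + 1)) * (Complex.I / 2)
        + ((coef w (2 * (p + 1) + 2) (2 * p + 2) : ℂ)
          + Complex.I * coef w (2 * (p + 1) + 1) (2 * p + 2)) *
          ((1 - Complex.I * coef w (2 * p + 2) (2 * p + 1)) / 2)) := by
      rw [tri22, hw.iota_succ_succ, hw.jota_succ_succ, hw.varsigma_succ_succ, hw.zeta_succ_succ,
        Nat.add_sub_cancel, hw.beta_succ]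
      linear_combination (1 / 2 * (coef w (2 * (p + 1) + 1) (2 * p + 1) : ℂ)
        - 1 / 2 * (coef w (2 * (p + 1) + 1) (2 * p + 2) : ℂ)
          * (coef w (2 * p + 2) (2 * p + 1) : ℂ)) * Complex.I_mul_I
    -- The last two summands are the only ones of frequency p + 1, hence the only sources of
    -- z^(-p-1).
    rw [h, show 2 * (p + 1) + 1 = (2 * p + 1) + 1 + 1 by ring, Finset.sum_range_succ,
      Finset.sum_range_succ]
    have h1 := cmon_odd_sub_mem w p
    have h2 := cmon_even_sub_mem w p
    have h3 : ∑ j ∈ Finset.range (2 * p + 1), ((coef w (2 * (p + 1) + 2) j : ℂ) +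
        Complex.I * coef w (2 * p + 1 + 1 + 1) j) • cmon w j ∈ laurent (-p) (p + 1) :=
      sum_cmon_mem w _ (m := p) (by omega) (by omega) (by omega)
    push_cast
    rw [show -((p : ℤ) + 1) + 1 = -p by ring]
    have h4 := neg_mem (add_mem (add_mem (Submodule.smul_mem _
      ((coef w (2 * (p + 1) + 2) (2 * p + 1) : ℂ)
          + Complex.I * coef w (2 * p + 1 + 1 + 1) (2 * p + 1)) h1)
      (Submodule.smul_mem _ ((coef w (2 * (p + 1) + 2) (2 * p + 2) : ℂ)
          + Complex.I * coef w (2 * p + 1 + 1 + 1) (2 * p + 2)) h2)) h3)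
    convert h4 using 1
    module

lemma IsWeight.evenCircle_succ (hw : IsWeight w) (m : ℕ) :
    evenCircle w (m + 1) = (-(1 / 2) * (ip w (monic w (2 * m + 2)) (monic w (2 * m + 2)) : ℂ)⁻¹ *
      (1 + coef w (2 * m + 2) (2 * m + 1) * Complex.I)) • cmon w (2 * m + 2) +
      (1 / 2 * (ip w (monic w (2 * m + 1)) (monic w (2 * m + 1)) : ℂ)⁻¹ * Complex.I) •
        cmon w (2 * m + 1) := by
  rw [evenCircle, combC, lam3, lam4, hw.beta_succ, inv_pow, inv_pow, ← Complex.ofReal_pow,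
    ← Complex.ofReal_pow, hw.sq_a_succ, hw.sq_b_succ]
  rfl

lemma evenCircle_zero (w : C(Circle, ℝ)) : evenCircle w 0 = -1 := by
  rw [evenCircle, combC, lam3, beta_zero, cosPart, sinPart, a, smul_smul, smul_zero]
  norm_num

lemma IsWeight.evenCircle_sub_mem (hw : IsWeight w) (m : ℕ) :
    evenCircle w m - tri21 w (m + 1) • zp (-m) ∈ laurent (-m + 1) m := by
  cases m with
  | zero =>
    -- The convention that `b₀⁻¹` is 0 is realized by `0⁻¹ = 0`.
    have h : tri21 w (0 + 1) = -1 := by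
      rw [tri21, Nat.add_sub_cancel, beta_zero, a, b]
      norm_num
    rw [h, evenCircle_zero]
    simp [zp_zero]
  | succ p =>
    have h : tri21 w (p + 1 + 1) =
        (-(1 / 2) * (ip w (monic w (2 * p + 2)) (monic w (2 * p + 2)) : ℂ)⁻¹ *
          (1 + coef w (2 * p + 2) (2 * p + 1) * Complex.I)) *
            ((1 - Complex.I * coef w (2 * p + 2) (2 * p + 1)) / 2) +
        (1 / 2 * (ip w (monic w (2 * p + 1)) (monic w (2 * p + 1)) : ℂ)⁻¹ * Complex.I) *
          (Complex.I / 2) := by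
      rw [tri21, Nat.add_sub_cancel, hw.beta_succ, inv_pow, inv_pow, ← Complex.ofReal_pow,
        ← Complex.ofReal_pow (b w _), hw.sq_a_succ, hw.sq_b_succ]
      linear_combination (-1 / 4 * (ip w (monic w (2 * p + 2)) (monic w (2 * p + 2)) : ℂ)⁻¹ *
        (coef w (2 * p + 2) (2 * p + 1) : ℂ) ^ 2 -
        1 / 4 * (ip w (monic w (2 * p + 1)) (monic w (2 * p + 1)) : ℂ)⁻¹) * Complex.I_mul_I
    rw [h, hw.evenCircle_succ]
    push_cast
    rw [show -((p : ℤ) + 1) + 1 = -p by ring]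
    have h4 := add_mem
      (Submodule.smul_mem _ (-(1 / 2) * (ip w (monic w (2 * p + 2)) (monic w (2 * p + 2)) : ℂ)⁻¹ *
          (1 + coef w (2 * p + 2) (2 * p + 1) * Complex.I)) (cmon_even_sub_mem w p))
      (Submodule.smul_mem _
        (1 / 2 * (ip w (monic w (2 * p + 1)) (monic w (2 * p + 1)) : ℂ)⁻¹ * Complex.I)
        (cmon_odd_sub_mem w p))
    convert h4 using 1
    module

/-- For m ≥ 1, z^(±m) pairs with aσ to a² and with bπ to b²(β ± i), so λ₃ and λ₄ give -(1 + βi)/2 +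
i(β ± i)/2: this is -1 for z^m and 0 for z^(-m). -/
lemma IsWeight.Lam_evenCircle_mul_zp (hw : IsWeight w) (m : ℕ) :
    Lam w (evenCircle w m * zp m) = -1 := by
  cases m with
  | zero =>
    rw [evenCircle_zero, Nat.cast_zero, zp_zero, neg_one_mul, map_neg, ← mul_one 1, ← cmon_zero w,
      Lam_cmon_mul_cmon, hw.ip_monic_zero, Complex.ofReal_one]
  | succ p =>
    push_cast
    rw [hw.evenCircle_succ, zp_eq_trigC]
    have h1 : (ip w (monic w (2 * p + 1)) (monic w (2 * p + 1)) : ℂ) ≠ 0 :=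
      Complex.ofReal_ne_zero.2 (hw.ip_monic_ne_zero _)
    have h2 : (ip w (monic w (2 * p + 2)) (monic w (2 * p + 2)) : ℂ) ≠ 0 :=
      Complex.ofReal_ne_zero.2 (hw.ip_monic_ne_zero _)
    simp only [add_mul, mul_add, smul_mul_assoc, mul_smul_comm, map_add, map_smul,
      hw.Lam_cmon_mul_trigC_self, hw.Lam_cmon_mul_trigC_of_lt (Nat.lt_succ_self (2 * p + 1)),
      hw.Lam_cmon_mul_trigC (2 * p + 2) (2 * p + 1), smul_eq_mul]
    field_simp
    linear_combination (ip w (monic w (2 * p + 2)) (monic w (2 * p + 2)) : ℂ) * Complex.I_mul_I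

lemma IsWeight.Lam_evenCircle_mul_zp_neg (hw : IsWeight w) (p : ℕ) :
    Lam w (evenCircle w (p + 1) * zp (-(p + 1))) = 0 := by
  rw [hw.evenCircle_succ, zp_neg_eq_trigC]
  have h1 : (ip w (monic w (2 * p + 1)) (monic w (2 * p + 1)) : ℂ) ≠ 0 :=
    Complex.ofReal_ne_zero.2 (hw.ip_monic_ne_zero _)
  have h2 : (ip w (monic w (2 * p + 2)) (monic w (2 * p + 2)) : ℂ) ≠ 0 :=
    Complex.ofReal_ne_zero.2 (hw.ip_monic_ne_zero _)
  simp only [add_mul, mul_sub, smul_mul_assoc, mul_smul_comm, map_add, map_sub, map_smul,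
    hw.Lam_cmon_mul_trigC_self, hw.Lam_cmon_mul_trigC_of_lt (Nat.lt_succ_self (2 * p + 1)),
    hw.Lam_cmon_mul_trigC (2 * p + 2) (2 * p + 1), smul_eq_mul]
  field_simp
  linear_combination
    (-ip w (monic w (2 * p + 2)) (monic w (2 * p + 2)) : ℂ) * Complex.I_mul_I

lemma IsWeight.Lam_evenCircle_mul_zp_of_lt (hw : IsWeight w) (m : ℕ) {k : ℤ} (h1 : -m ≤ k)
    (h2 : k < m) : Lam w (evenCircle w m * zp k) = 0 := by
  cases m with
  | zero => omega
  | succ p =>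
    push_cast at h1 h2
    rcases h1.eq_or_lt with rfl | h1
    · exact hw.Lam_evenCircle_mul_zp_neg p
    · have h : zp k ∈ laurent (-p) p := zp_mem (by omega) (by omega)
      rw [hw.evenCircle_succ, add_mul, smul_mul_assoc, smul_mul_assoc, map_add, map_smul, map_smul,
        hw.Lam_cmon_mul_of_mem (by omega) h, hw.Lam_cmon_mul_of_mem (by omega) h, smul_zero,
        smul_zero, add_zero]

lemma conj_tri22 (w : Circle → ℝ) (n : ℕ) : conj (tri22 w n) = tri11 w n := by
  simp [tri22, tri11, Complex.conj_ofNat]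
  ring

lemma evenCircle_mem (w : C(Circle, ℝ)) (m : ℕ) : evenCircle w m ∈ laurent (-m) m :=
  combC_mem w m _ _

lemma oddCircle_mem (w : C(Circle, ℝ)) (m : ℕ) : oddCircle w m ∈ laurent (-m) m :=
  combC_mem w m _ _

/-! ### The Szegő-type recurrences -/

lemma Lam_star_mul_zp (w : C(Circle, ℝ)) (f : C(Circle, ℂ)) (k : ℤ) :
    Lam w (star f * zp k) = conj (Lam w (f * zp (-k))) := by
  rw [← Lam_star, star_mul', star_zp, neg_neg]

lemma Lam_zp_mul_mul_zp (w : C(Circle, ℝ)) (f : C(Circle, ℂ)) (j k : ℤ) :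
    Lam w (zp j * f * zp k) = Lam w (f * zp (j + k)) := by
  rw [mul_comm (zp j), mul_assoc, zp_mul_zp]

/-- Compute L(D E*) in two ways. It is the conjugate of L(E D*) = 0; expanding E* = z^(-m-1) +
conj(△₂₂) z^m + (exponents -m..m-1) gives L(D z^(-m-1)) - conj(△₂₂). -/
lemma IsWeight.Lam_evenCircle_mul_zp_succ_neg (hw : IsWeight w) (m : ℕ) :
    Lam w (evenCircle w m * zp (-(m + 1))) = tri11 w (m + 1) := by
  have hX := star_mem_laurent (p' := -m) (q' := m - 1) (hw.oddCircle_sub_mem m)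
    (by omega) (by omega)
  have h0 := Lam_mul_eq_zero w hX (g := evenCircle w m)
    fun k h1 h2 => hw.Lam_evenCircle_mul_zp_of_lt m h1 (by omega)
  have h1 := Lam_star w (oddCircle w (m + 1) * star (evenCircle w m))
  rw [hw.Lam_oddCircle_mul m (star_mem_laurent (evenCircle_mem w m) (by omega) (by omega)),
    star_mul', star_star, map_zero, mul_comm] at h1
  rw [star_sub, star_sub, star_smul, star_zp, star_zp, mul_sub, mul_sub, mul_smul_comm, map_sub,
    map_sub, map_smul, h1, neg_neg, hw.Lam_evenCircle_mul_zp, ← starRingEnd_apply, conj_tri22,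
    smul_eq_mul] at h0
  linear_combination -h0

lemma IsWeight.Lam_oddCircle_mul_zp (hw : IsWeight w) (m : ℕ) {k : ℤ} (h1 : -m ≤ k)
    (h2 : k ≤ m) : Lam w (oddCircle w (m + 1) * zp k) = 0 :=
  hw.Lam_oddCircle_mul m (zp_mem h1 h2)

/-- The recurrence expressing the odd function through conjugates. -/
lemma IsWeight.zp_mul_oddCircle (hw : IsWeight w) (m : ℕ) :
    zp (-1) * oddCircle w (m + 1) = tri22 w (m + 1) • star (oddCircle w (m + 1))
      - tri12 w (m + 1) • star (evenCircle w m) := by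
  have hX := hw.oddCircle_sub_mem m
  have hR : zp (-1) * oddCircle w (m + 1) - tri22 w (m + 1) • star (oddCircle w (m + 1))
      + tri12 w (m + 1) • star (evenCircle w m) = 0 := by
    refine hw.eq_zero_of_orthogonal (m := m) ?_ fun k h1 h2 => ?_
    -- The terms △₂₂ z^(-m-1) of z⁻¹E and of △₂₂ E* cancel, leaving exponents in -m..m.
    · have h : zp (-1) * oddCircle w (m + 1) - tri22 w (m + 1) • star (oddCircle w (m + 1))
          = zp (-1) * (oddCircle w (m + 1) - zp (m + 1) - tri22 w (m + 1) • zp (-m))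
            - tri22 w (m + 1) •
              star (oddCircle w (m + 1) - zp (m + 1) - tri22 w (m + 1) • zp (-m))
            + (1 - tri22 w (m + 1) * star (tri22 w (m + 1))) • zp m := by
        rw [star_sub, star_sub, star_smul, star_zp, star_zp, neg_neg, mul_sub, mul_sub,
          mul_smul_comm, zp_mul_zp, zp_mul_zp, show (-1 : ℤ) + (m + 1) = m by ring,
          show (-1 : ℤ) + -m = -(m + 1) by ring]
        module
      rw [h]
      refine add_mem (add_mem (sub_mem ?_ (Submodule.smul_mem _ _ ?_))
        (Submodule.smul_mem _ _ (zp_mem (by omega) (by omega)))) (Submodule.smul_mem _ _ ?_)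
      · exact zp_mul_mem _ hX (by omega) (by omega)
      · exact star_mem_laurent hX (by omega) (by omega)
      · exact star_mem_laurent (evenCircle_mem w m) (by omega) (by omega)
    · rw [add_mul, sub_mul, smul_mul_assoc, smul_mul_assoc, map_add, map_sub, map_smul, map_smul,
        Lam_star_mul_zp, Lam_star_mul_zp, Lam_zp_mul_mul_zp,
        hw.Lam_oddCircle_mul_zp m (k := -k) (by omega) (by omega)]
      -- At k = -m the two nonzero pairings are △₁₂ and △₁₂ · (-1); for larger k every term
      -- vanishes.
      rcases h1.eq_or_lt with rfl | h1
      · rw [show -1 + -(m : ℤ) = -(m + 1) by ring, hw.Lam_oddCircle_mul_zp_neg, neg_neg,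
          hw.Lam_evenCircle_mul_zp]
        simp
      · rw [hw.Lam_oddCircle_mul_zp m (by omega) (by omega),
          hw.Lam_evenCircle_mul_zp_of_lt m (by omega) (by omega)]
        simp
  linear_combination (exp := 1) hR

/-- The recurrence expressing the even function through conjugates. -/
lemma IsWeight.zp_mul_evenCircle (hw : IsWeight w) (m : ℕ) :
    zp (-1) * evenCircle w m = tri21 w (m + 1) • star (oddCircle w (m + 1))
      - tri11 w (m + 1) • star (evenCircle w m) := by
  have hX := hw.oddCircle_sub_mem m
  have hY := hw.evenCircle_sub_mem m
  have hR : zp (-1) * evenCircle w m - tri21 w (m + 1) • star (oddCircle w (m + 1))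
      + tri11 w (m + 1) • star (evenCircle w m) = 0 := by
    refine hw.eq_zero_of_orthogonal (m := m) ?_ fun k h1 h2 => ?_
    · have h : zp (-1) * evenCircle w m - tri21 w (m + 1) • star (oddCircle w (m + 1))
          = zp (-1) * (evenCircle w m - tri21 w (m + 1) • zp (-m))
            - tri21 w (m + 1) •
              star (oddCircle w (m + 1) - zp (m + 1) - tri22 w (m + 1) • zp (-m))
            - (tri21 w (m + 1) * star (tri22 w (m + 1))) • zp m := by
        rw [star_sub, star_sub, star_smul, star_zp, star_zp, neg_neg, mul_sub,
          mul_smul_comm, zp_mul_zp, show (-1 : ℤ) + -m = -(m + 1) by ring]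
        module
      rw [h]
      refine add_mem (sub_mem (sub_mem ?_ (Submodule.smul_mem _ _ ?_))
        (Submodule.smul_mem _ _ (zp_mem (by omega) (by omega)))) (Submodule.smul_mem _ _ ?_)
      · exact zp_mul_mem _ hY (by omega) (by omega)
      · exact star_mem_laurent hX (by omega) (by omega)
      · exact star_mem_laurent (evenCircle_mem w m) (by omega) (by omega)
    · rw [add_mul, sub_mul, smul_mul_assoc, smul_mul_assoc, map_add, map_sub, map_smul, map_smul,
        Lam_star_mul_zp, Lam_star_mul_zp, Lam_zp_mul_mul_zp,
        hw.Lam_oddCircle_mul_zp m (k := -k) (by omega) (by omega)]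
      rcases h1.eq_or_lt with rfl | h1
      · rw [show -1 + -(m : ℤ) = -(m + 1) by ring, hw.Lam_evenCircle_mul_zp_succ_neg, neg_neg,
          hw.Lam_evenCircle_mul_zp]
        simp
      · rw [hw.Lam_evenCircle_mul_zp_of_lt m (k := -1 + k) (by omega) (by omega),
          hw.Lam_evenCircle_mul_zp_of_lt m (by omega) (by omega)]
        simp
  linear_combination (exp := 1) hR

/-! ### Existence of principal values for Hölder functions -/

lemma intervalIntegrable_abs_rpow {s : ℝ} (hs : -1 < s) (c : ℝ) (hc : 0 ≤ c) :
    IntervalIntegrable (fun x : ℝ => |x| ^ s) MeasureTheory.volume (-c) c := by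
  have h : IntervalIntegrable (fun x : ℝ => |x| ^ s) MeasureTheory.volume 0 c := by
    refine (intervalIntegral.intervalIntegrable_rpow' hs).congr fun x hx => ?_
    rw [Set.uIoc_of_le hc] at hx
    simp only [abs_of_pos hx.1]
  have h' := h.comp_sub_left 0
  simp only [zero_sub, abs_neg, neg_zero] at h'
  exact h'.symm.trans h

/-- The chord has length 2|sin((θ - θ₀)/2)|, bounded below by Jordan's inequality. -/
lemma le_norm_exp_sub_exp {θ₀ θ : ℝ} (h : |θ - θ₀| ≤ Real.pi) :
    2 / Real.pi * |θ - θ₀| ≤ ‖(Circle.exp θ₀ : ℂ) - Circle.exp θ‖ := by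
  have h1 : (Circle.exp θ₀ : ℂ) - Circle.exp θ =
      -(Circle.exp θ₀ * (Complex.exp (Complex.I * (θ - θ₀ : ℝ)) - 1)) := by
    rw [Circle.coe_exp, Circle.coe_exp, mul_sub, ← Complex.exp_add]
    push_cast
    ring_nf
  rw [h1, norm_neg, norm_mul, Circle.norm_coe, one_mul, Complex.norm_exp_I_mul_ofReal_sub_one,
    norm_mul, Real.norm_two, Real.norm_eq_abs]
  have h2 := Real.mul_abs_le_abs_sin (x := (θ - θ₀) / 2) (by
    rw [abs_div, abs_two]; linarith)
  rw [abs_div, abs_two] at h2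
  linarith

lemma intervalIntegrable_norm_sub_rpow (t : Circle) {s : ℝ} (hs : -1 < s) :
    IntervalIntegrable (fun θ : ℝ => ‖(t : ℂ) - Circle.exp θ‖ ^ s) MeasureTheory.volume
      0 (2 * Real.pi) := by
  rcases le_or_gt 0 s with h0 | h0
  · exact Continuous.intervalIntegrable
      (Continuous.rpow_const (by fun_prop) fun _ => Or.inr h0) _ _
  obtain ⟨θ₀, rfl⟩ := Circle.exp_surjective t
  have hper : Function.Periodic (fun θ : ℝ => ‖(Circle.exp θ₀ : ℂ) - Circle.exp θ‖ ^ s)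
      (2 * Real.pi) := fun θ => by simp only [Circle.periodic_exp θ]
  -- By periodicity the period may be centred at the singularity, where the chord bound applies.
  refine hper.intervalIntegrable Real.two_pi_pos.ne' (t := -Real.pi + θ₀) ?_ _ _
  have hI := ((intervalIntegrable_abs_rpow hs _ Real.pi_pos.le).comp_sub_right θ₀).const_mul
    ((2 / Real.pi) ^ s)
  rw [show -Real.pi + θ₀ + 2 * Real.pi = Real.pi + θ₀ by ring]
  refine hI.mono_fun' ?_ ?_
  · exact Measurable.aestronglyMeasurable (by fun_prop)
  · rw [Filter.EventuallyLE, MeasureTheory.ae_restrict_iff' measurableSet_uIoc]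
    refine Filter.Eventually.of_forall fun θ hθ => ?_
    rw [Set.uIoc_of_le (by linarith [Real.pi_pos])] at hθ
    have habs : |θ - θ₀| ≤ Real.pi := abs_le.2 ⟨by linarith [hθ.1], by linarith [hθ.2]⟩
    rw [Real.norm_of_nonneg (by positivity), ← Real.mul_rpow (by positivity) (abs_nonneg _)]
    rcases eq_or_ne θ θ₀ with rfl | hne
    · simp
    · have : 0 < |θ - θ₀| := abs_pos.2 (sub_ne_zero.2 hne)
      exact Real.rpow_le_rpow_of_nonpos (by positivity) (le_norm_exp_sub_exp habs) h0.le

lemma ae_circle_exp_ne (t : Circle) : ∀ᵐ θ : ℝ, Circle.exp θ ≠ t := by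
  obtain ⟨θ₀, rfl⟩ := Circle.exp_surjective t
  have h : ({θ : ℝ | Circle.exp θ = Circle.exp θ₀}).Countable := by
    refine (Set.countable_range fun n : ℤ => θ₀ + n * (2 * Real.pi)).mono fun θ hθ => ?_
    obtain ⟨m, hm⟩ := Circle.exp_eq_exp.1 hθ
    exact ⟨m, hm.symm⟩
  simpa using h.ae_notMem MeasureTheory.volume

lemma measurableSet_lt_norm_sub (t : Circle) (ε : ℝ) :
    MeasurableSet {θ : ℝ | ε < ‖(t : ℂ) - Circle.exp θ‖} :=
  (isOpen_lt continuous_const (by fun_prop)).measurableSet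

lemma tendsto_truncated_integral (t : Circle) {g : ℝ → ℂ}
    (hg : IntervalIntegrable g MeasureTheory.volume 0 (2 * Real.pi)) :
    Filter.Tendsto (fun ε : ℝ => ∫ θ in (0 : ℝ)..(2 * Real.pi),
      if ε < ‖(t : ℂ) - Circle.exp θ‖ then g θ else 0) (𝓝[>] 0)
      (𝓝 (∫ θ in (0 : ℝ)..(2 * Real.pi), g θ)) := by
  refine intervalIntegral.tendsto_integral_filter_of_dominated_convergence (fun θ => ‖g θ‖)
    (Filter.Eventually.of_forall fun ε => ?_)
    (Filter.Eventually.of_forall fun ε => Filter.Eventually.of_forall fun θ _ => ?_) hg.norm ?_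
  · exact hg.aestronglyMeasurable_restrict_uIoc.indicator (measurableSet_lt_norm_sub t ε)
  · split_ifs <;> simp
  · filter_upwards [ae_circle_exp_ne t] with θ hθ _
    have hpos : 0 < ‖(t : ℂ) - Circle.exp θ‖ :=
      norm_pos_iff.2 (sub_ne_zero.2 fun h => hθ (Circle.ext h).symm)
    refine tendsto_const_nhds.congr' ?_
    filter_upwards [Ioo_mem_nhdsGT hpos] with ε hε
    rw [if_pos hε.2]

lemma intervalIntegrable_truncated {f : Circle → ℂ} (hf : Continuous f) (t : Circle) {ε : ℝ}
    (hε : 0 < ε) : IntervalIntegrable (fun θ : ℝ => if ε < ‖(t : ℂ) - Circle.exp θ‖ then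
      f (Circle.exp θ) / ((t : ℂ) - Circle.exp θ) * (Complex.I * Circle.exp θ) else 0)
      MeasureTheory.volume 0 (2 * Real.pi) := by
  have hb : IntervalIntegrable (fun θ : ℝ => ‖f (Circle.exp θ)‖ / ε) MeasureTheory.volume
      0 (2 * Real.pi) := Continuous.intervalIntegrable (by fun_prop) _ _
  refine hb.mono_fun' ?_ (Filter.Eventually.of_forall fun θ => ?_)
  · have h1 : Measurable fun θ : ℝ => f (Circle.exp θ) :=
      Continuous.measurable (by fun_prop)
    have h2 : Measurable fun θ : ℝ => (Circle.exp θ : ℂ) := Continuous.measurable (by fun_prop)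
    exact (Measurable.ite (measurableSet_lt_norm_sub t ε)
      ((h1.div (measurable_const.sub h2)).mul (measurable_const.mul h2))
      measurable_const).aestronglyMeasurable
  · dsimp only
    split_ifs with h
    · rw [norm_mul, norm_mul, Complex.norm_I, Circle.norm_coe, norm_div, mul_one, mul_one]
      gcongr
    · rw [norm_zero]
      positivity

/-- The truncated integral of the kernel itself: symmetrize by `τ ↦ t² / τ`. -/
lemma two_mul_truncated_kernel (t : Circle) {ε : ℝ} (hε : 0 < ε) :
    2 * ∫ θ in (0 : ℝ)..(2 * Real.pi), (if ε < ‖(t : ℂ) - Circle.exp θ‖ then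
      (1 : ℂ) / ((t : ℂ) - Circle.exp θ) * (Complex.I * Circle.exp θ) else 0) =
    ∫ θ in (0 : ℝ)..(2 * Real.pi), if ε < ‖(t : ℂ) - Circle.exp θ‖ then -Complex.I else 0 := by
  have hint := intervalIntegrable_truncated (f := fun _ => 1) continuous_const t hε
  set k : ℝ → ℂ := fun θ => if ε < ‖(t : ℂ) - Circle.exp θ‖ then
      (1 : ℂ) / ((t : ℂ) - Circle.exp θ) * (Complex.I * Circle.exp θ) else 0 with hk
  have hper : Function.Periodic k (2 * Real.pi) := fun θ => by
    simp only [hk, Circle.periodic_exp θ]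
  obtain ⟨θ₀, rfl⟩ := Circle.exp_surjective t
  have hsub : ∫ θ in (0 : ℝ)..(2 * Real.pi), k (2 * θ₀ - θ) =
      ∫ θ in (0 : ℝ)..(2 * Real.pi), k θ := by
    rw [intervalIntegral.integral_comp_sub_left, sub_zero]
    have := hper.intervalIntegral_add_eq (2 * θ₀ - 2 * Real.pi) 0
    rwa [sub_add_cancel, zero_add] at this
  have hint' : IntervalIntegrable (fun θ => k (2 * θ₀ - θ)) MeasureTheory.volume
      0 (2 * Real.pi) := by
    have h := (hper.intervalIntegrable Real.two_pi_pos.ne' (t := 0) (by rwa [zero_add])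
      (2 * θ₀) (2 * θ₀ - 2 * Real.pi)).comp_sub_left (2 * θ₀)
    simpa using h
  rw [two_mul]
  nth_rewrite 1 [← hsub]
  rw [← intervalIntegral.integral_add hint' hint]
  refine intervalIntegral.integral_congr fun θ _ => ?_
  have ht : (Circle.exp θ₀ : ℂ) ≠ 0 := Circle.coe_ne_zero _
  have hτ : (Circle.exp θ : ℂ) ≠ 0 := Circle.coe_ne_zero _
  have hexp : (Circle.exp (2 * θ₀ - θ) : ℂ) = (Circle.exp θ₀ : ℂ) ^ 2 / Circle.exp θ := by
    rw [two_mul, Circle.exp_sub, Circle.exp_add, Circle.coe_div, Circle.coe_mul, sq]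
  -- The reflection τ ↦ t²/τ preserves |t - τ|, hence the truncation, and the two kernel values add
  -- up to -i.
  have hdiff : (Circle.exp θ₀ : ℂ) - (Circle.exp θ₀ : ℂ) ^ 2 / Circle.exp θ =
      -((Circle.exp θ₀ : ℂ) / Circle.exp θ * ((Circle.exp θ₀ : ℂ) - Circle.exp θ)) := by
    field_simp
    ring
  have hnorm : ‖(Circle.exp θ₀ : ℂ) - (Circle.exp θ₀ : ℂ) ^ 2 / Circle.exp θ‖ =
      ‖(Circle.exp θ₀ : ℂ) - Circle.exp θ‖ := by
    rw [hdiff, norm_neg, norm_mul, norm_div, Circle.norm_coe, Circle.norm_coe, div_one, one_mul]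
  simp only [hk, hexp, hnorm]
  split_ifs with h
  · have hne : (Circle.exp θ₀ : ℂ) - Circle.exp θ ≠ 0 := norm_pos_iff.1 (hε.trans h)
    rw [hdiff]
    field_simp
    ring
  · simp

lemma tendsto_truncated_kernel (t : Circle) :
    Filter.Tendsto (fun ε : ℝ => ∫ θ in (0 : ℝ)..(2 * Real.pi),
      (if ε < ‖(t : ℂ) - Circle.exp θ‖ then
      (1 : ℂ) / ((t : ℂ) - Circle.exp θ) * (Complex.I * Circle.exp θ) else 0)) (𝓝[>] 0)
      (𝓝 (-(Real.pi * Complex.I))) := by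
  have h := (tendsto_truncated_integral t (g := fun _ => -Complex.I)
    (by simp)).const_mul (2⁻¹ : ℂ)
  have hval : (2⁻¹ : ℂ) * ∫ _ in (0 : ℝ)..(2 * Real.pi), -Complex.I = -(Real.pi * Complex.I) := by
    rw [intervalIntegral.integral_const]
    simp
    ring
  rw [hval] at h
  refine h.congr' ?_
  filter_upwards [self_mem_nhdsWithin] with ε hε
  rw [← two_mul_truncated_kernel t hε, inv_mul_cancel_left₀ two_ne_zero]

/-- A pointwise Hölder condition at `t`. -/
def HolderAt (f : Circle → ℂ) (t : Circle) : Prop :=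
  ∃ C L r : ℝ, 0 ≤ C ∧ 0 ≤ L ∧ 0 < r ∧
    ∀ τ : Circle, ‖f τ - f t‖ ≤ C * ‖(t : ℂ) - τ‖ ^ r + L * ‖(t : ℂ) - τ‖

lemma HolderAt.intervalIntegrable {f : Circle → ℂ} {t : Circle} (h : HolderAt f t)
    (hf : Continuous f) : IntervalIntegrable (fun θ : ℝ => (f (Circle.exp θ) - f t) /
      ((t : ℂ) - Circle.exp θ) * (Complex.I * Circle.exp θ)) MeasureTheory.volume
      0 (2 * Real.pi) := by
  obtain ⟨C, L, r, hC, hL, hr, hb⟩ := h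
  have hI : IntervalIntegrable (fun θ : ℝ => C * ‖(t : ℂ) - Circle.exp θ‖ ^ (r - 1) + L)
      MeasureTheory.volume 0 (2 * Real.pi) :=
    ((intervalIntegrable_norm_sub_rpow t (by linarith)).const_mul C).add (by simp)
  refine hI.mono_fun' ?_ (Filter.Eventually.of_forall fun θ => ?_)
  · have h1 : Measurable fun θ : ℝ => f (Circle.exp θ) - f t :=
      Continuous.measurable (by fun_prop)
    have h2 : Measurable fun θ : ℝ => (Circle.exp θ : ℂ) := Continuous.measurable (by fun_prop)
    exact ((h1.div (measurable_const.sub h2)).mul (measurable_const.mul h2)).aestronglyMeasurable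
  · dsimp only
    rw [norm_mul, norm_mul, Complex.norm_I, Circle.norm_coe, norm_div, mul_one, mul_one]
    -- At τ = t the quotient is 0 by the convention for division by zero.
    rcases (norm_nonneg ((t : ℂ) - Circle.exp θ)).eq_or_lt with h0 | h0
    · rw [← h0, div_zero]
      positivity
    · rw [div_le_iff₀ h0, add_mul, mul_assoc, ← Real.rpow_add_one h0.ne', sub_add_cancel]
      exact hb _

/-- Split f as (f - f(t)) + f(t): the first part is absolutely integrable against the kernel, and
the kernel itself contributes -πi. -/
lemma HolderAt.tendsto_truncatedHilbert {f : Circle → ℂ} {t : Circle} (h : HolderAt f t)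
    (hf : Continuous f) : Filter.Tendsto (truncatedHilbert f t) (𝓝[>] 0)
      (𝓝 ((Real.pi : ℂ)⁻¹ * ((∫ θ in (0 : ℝ)..(2 * Real.pi), (f (Circle.exp θ) - f t) /
        ((t : ℂ) - Circle.exp θ) * (Complex.I * Circle.exp θ))
        + f t * -(Real.pi * Complex.I)))) := by
  refine (((tendsto_truncated_integral t (h.intervalIntegrable hf)).add
    ((tendsto_truncated_kernel t).const_mul (f t))).const_mul (Real.pi : ℂ)⁻¹).congr' ?_
  filter_upwards [self_mem_nhdsWithin] with ε hε
  rw [truncatedHilbert, ← intervalIntegral.integral_const_mul, ← intervalIntegral.integral_add]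
  · congr 2
    funext θ
    split_ifs
    · ring
    · simp
  · exact intervalIntegrable_truncated (f := fun τ => f τ - f t) (by fun_prop) t hε
  · exact (intervalIntegrable_truncated (f := fun _ => 1) continuous_const t hε).const_mul _

/-! ### Hilbert transforms of weighted Laurent polynomials -/

lemma zp_natCast_lipschitz (k : ℕ) (τ t : Circle) :
    ‖zp k τ - zp k t‖ ≤ k * ‖(t : ℂ) - τ‖ := by
  simp only [zp_apply, zpow_natCast]
  induction k with
  | zero => simp
  | succ k ih =>
    have h : (τ : ℂ) ^ (k + 1) - (t : ℂ) ^ (k + 1) =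
        τ * ((τ : ℂ) ^ k - (t : ℂ) ^ k) - (t - τ) * (t : ℂ) ^ k := by ring
    rw [h]
    refine (norm_sub_le _ _).trans ?_
    rw [norm_mul, norm_mul, norm_pow, Circle.norm_coe, Circle.norm_coe, one_pow]
    push_cast
    linarith

lemma exists_lipschitz_of_mem_laurent {p q : ℤ} {f : C(Circle, ℂ)} (hf : f ∈ laurent p q) :
    ∃ L : ℝ, 0 ≤ L ∧ ∀ τ t : Circle, ‖f τ - f t‖ ≤ L * ‖(t : ℂ) - τ‖ := by
  induction hf using Submodule.span_induction with
  | mem x hx =>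
    obtain ⟨k, -, rfl⟩ := hx
    obtain ⟨k, rfl | rfl⟩ := k.eq_nat_or_neg
    · exact ⟨k, k.cast_nonneg, zp_natCast_lipschitz k⟩
    · refine ⟨k, k.cast_nonneg, fun τ t => ?_⟩
      rw [← star_zp, ContinuousMap.star_apply, ContinuousMap.star_apply, ← star_sub, norm_star]
      exact zp_natCast_lipschitz k τ t
  | zero => exact ⟨0, le_rfl, by simp⟩
  | add x y _ _ hx hy =>
    obtain ⟨L, hL, h⟩ := hx
    obtain ⟨M, hM, h'⟩ := hy
    refine ⟨L + M, add_nonneg hL hM, fun τ t => ?_⟩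
    rw [ContinuousMap.add_apply, ContinuousMap.add_apply, add_sub_add_comm, add_mul]
    exact (norm_add_le _ _).trans (add_le_add (h τ t) (h' τ t))
  | smul c x _ hx =>
    obtain ⟨L, hL, h⟩ := hx
    refine ⟨‖c‖ * L, by positivity, fun τ t => ?_⟩
    rw [ContinuousMap.smul_apply, ContinuousMap.smul_apply, ← smul_sub, norm_smul, mul_assoc]
    exact mul_le_mul_of_nonneg_left (h τ t) (norm_nonneg c)

/-- The function `τ ↦ P(τ) w(τ)`. -/
noncomputable def weighted (w : C(Circle, ℝ)) (P : C(Circle, ℂ)) (τ : Circle) : ℂ :=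
  P τ * (w τ : ℂ)

lemma continuous_weighted (w : C(Circle, ℝ)) (P : C(Circle, ℂ)) : Continuous (weighted w P) := by
  unfold weighted
  fun_prop

lemma holderAt_weighted {C r : ℝ≥0} (hr : 0 < r) (hw : HolderWith C r w) {p q : ℤ}
    {P : C(Circle, ℂ)} (hP : P ∈ laurent p q) (t : Circle) : HolderAt (weighted w P) t := by
  obtain ⟨L, hL, h⟩ := exists_lipschitz_of_mem_laurent hP
  refine ⟨‖P‖ * C, L * ‖(w t : ℂ)‖, r, by positivity, by positivity, hr, fun τ => ?_⟩
  have heq : weighted w P τ - weighted w P t =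
      P τ * ((w τ - w t : ℝ) : ℂ) + (P τ - P t) * (w t : ℂ) := by
    unfold weighted
    push_cast
    ring
  have hdist : dist τ t = ‖(t : ℂ) - τ‖ := by
    rw [dist_comm]
    exact dist_eq_norm (t : ℂ) τ
  have h1 : ‖((w τ - w t : ℝ) : ℂ)‖ ≤ C * ‖(t : ℂ) - τ‖ ^ (r : ℝ) := by
    rw [Complex.norm_real, ← dist_eq_norm, ← hdist]
    exact hw.dist_le τ t
  rw [heq]
  refine (norm_add_le _ _).trans ?_
  rw [norm_mul, norm_mul, mul_assoc, mul_right_comm L]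
  exact add_le_add (mul_le_mul (P.norm_coe_le_norm τ) h1 (norm_nonneg _) (norm_nonneg _))
    (mul_le_mul_of_nonneg_right (h τ t) (norm_nonneg _))

lemma hilbertExists_weighted {C r : ℝ≥0} (hr : 0 < r) (hw : HolderWith C r w) {p q : ℤ}
    {P : C(Circle, ℂ)} (hP : P ∈ laurent p q) (t : Circle) : HilbertExists (weighted w P) t :=
  ⟨_, (holderAt_weighted hr hw hP t).tendsto_truncatedHilbert (continuous_weighted w P)⟩

lemma HilbertExists.tendsto {f : Circle → ℂ} {t : Circle} (h : HilbertExists f t) :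
    Filter.Tendsto (truncatedHilbert f t) (𝓝[>] 0) (𝓝 (hilbert f t)) :=
  tendsto_nhds_limUnder h

lemma truncatedHilbert_weighted_add_smul (w : C(Circle, ℝ)) (P Q : C(Circle, ℂ)) (c : ℂ)
    (t : Circle) {ε : ℝ} (hε : 0 < ε) :
    truncatedHilbert (weighted w (P + c • Q)) t ε =
      truncatedHilbert (weighted w P) t ε + c * truncatedHilbert (weighted w Q) t ε := by
  unfold truncatedHilbert
  rw [mul_left_comm, ← mul_add, ← intervalIntegral.integral_const_mul c,
    ← intervalIntegral.integral_add (intervalIntegrable_truncated (continuous_weighted w P) t hε)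
      ((intervalIntegrable_truncated (continuous_weighted w Q) t hε).const_mul c)]
  congr 2
  funext θ
  split_ifs
  · simp only [weighted, ContinuousMap.add_apply, ContinuousMap.smul_apply, smul_eq_mul]
    ring
  · simp

lemma hilbert_weighted_add_smul {C r : ℝ≥0} (hr : 0 < r) (hw : HolderWith C r w) {p q p' q' : ℤ}
    {P Q : C(Circle, ℂ)} (hP : P ∈ laurent p q) (hQ : Q ∈ laurent p' q') (c : ℂ) (t : Circle) :
    hilbert (weighted w (P + c • Q)) t =
      hilbert (weighted w P) t + c * hilbert (weighted w Q) t := by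
  refine Filter.Tendsto.limUnder_eq (Filter.Tendsto.congr' ?_
    ((hilbertExists_weighted hr hw hP t).tendsto.add
      ((hilbertExists_weighted hr hw hQ t).tendsto.const_mul c)))
  filter_upwards [self_mem_nhdsWithin] with ε hε
  exact (truncatedHilbert_weighted_add_smul w P Q c t hε).symm

/-! ### Monomial factors and the Hilbert transform -/

/-- A geometric sum in x⁻¹ and y⁻¹. The extra factor x comes from dτ = iτ dθ and makes the exponents
of x start at 0. -/
lemma kernel_identity {x y : ℂ} (hx : x ≠ 0) (hy : y ≠ 0) (hxy : y - x ≠ 0) (N : ℕ) :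
    (x ^ (-(N : ℤ)) - y ^ (-(N : ℤ))) / (y - x) * x =
      ∑ k ∈ Finset.range N, y⁻¹ * y⁻¹ ^ (N - 1 - k) * x ^ (-(k : ℤ)) := by
  have h := (Commute.all x⁻¹ y⁻¹).geom_sum₂_mul N
  have h1 : x⁻¹ - y⁻¹ = (y - x) * (x⁻¹ * y⁻¹) := by field_simp
  simp only [zpow_neg, zpow_natCast, ← inv_pow]
  rw [← h, h1, ← mul_assoc, mul_right_comm, mul_div_assoc, div_self hxy, mul_one, mul_assoc,
    mul_comm x⁻¹, mul_assoc, inv_mul_cancel₀ hx, mul_one, Finset.sum_mul]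
  exact Finset.sum_congr rfl fun k _ => by ring

/-- Multiplication by `τ ^ (-N)` commutes with the Hilbert transform of `Q w`, provided that `Q` is
orthogonal to enough monomials. -/
lemma hilbert_weighted_zp_mul {C r : ℝ≥0} (hr : 0 < r) (hw : HolderWith C r w) {p q : ℤ}
    {Q : C(Circle, ℂ)} (hQ : Q ∈ laurent p q) (N : ℕ)
    (horth : ∀ k < N, Lam w (Q * zp (-(k : ℤ))) = 0) (t : Circle) :
    hilbert (weighted w (zp (-(N : ℤ)) * Q)) t =
      (t : ℂ) ^ (-(N : ℤ)) * hilbert (weighted w Q) t := by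
  have hZ : zp (-(N : ℤ)) * Q ∈ laurent (-(N : ℤ) + p) (-(N : ℤ) + q) :=
    zp_mul_mem _ hQ le_rfl le_rfl
  have hU : zp (-(N : ℤ)) * Q + (-(t : ℂ) ^ (-(N : ℤ))) • Q ∈
      laurent (-(N : ℤ) + p) q :=
    add_mem (laurent_mono le_rfl (by omega) hZ)
      (Submodule.smul_mem _ _ (laurent_mono (by omega) le_rfl hQ))
  have hlin := hilbert_weighted_add_smul hr hw hZ hQ (-(t : ℂ) ^ (-(N : ℤ))) t
  have hlim : hilbert (weighted w (zp (-(N : ℤ)) * Q + (-(t : ℂ) ^ (-(N : ℤ))) • Q)) t = _ :=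
    ((holderAt_weighted hr hw hU t).tendsto_truncatedHilbert
      (continuous_weighted w _)).limUnder_eq
  -- The function (τ^(-N) - t^(-N)) Q w vanishes at τ = t, so its transform is an ordinary integral.
  have hUt : weighted w (zp (-(N : ℤ)) * Q + (-(t : ℂ) ^ (-(N : ℤ))) • Q) t = 0 := by
    simp [weighted, zp_apply]
  set V : C(Circle, ℂ) := ∑ k ∈ Finset.range N,
    ((t : ℂ)⁻¹ * (t : ℂ)⁻¹ ^ (N - 1 - k)) • zp (-(k : ℤ)) with hV
  have hQV : Lam w (Q * V) = 0 := by
    rw [hV, Finset.mul_sum, map_sum]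
    refine Finset.sum_eq_zero fun k hk => ?_
    rw [mul_smul_comm, map_smul, horth k (Finset.mem_range.1 hk), smul_zero]
  have hint : ∫ θ in (0 : ℝ)..(2 * Real.pi), (Q * V) (Circle.exp θ) * (w (Circle.exp θ) : ℂ) = 0 :=
    (mul_eq_zero.1 hQV).resolve_left (inv_ne_zero (by simp [Real.pi_ne_zero]))
  have hcongr : ∫ θ in (0 : ℝ)..(2 * Real.pi),
      weighted w (zp (-(N : ℤ)) * Q + (-(t : ℂ) ^ (-(N : ℤ))) • Q) (Circle.exp θ) /
        ((t : ℂ) - Circle.exp θ) * (Complex.I * Circle.exp θ) =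
      ∫ θ in (0 : ℝ)..(2 * Real.pi),
        Complex.I * ((Q * V) (Circle.exp θ) * (w (Circle.exp θ) : ℂ)) := by
    refine intervalIntegral.integral_congr_ae ?_
    filter_upwards [ae_circle_exp_ne t] with θ hθ _
    have hne : (t : ℂ) - Circle.exp θ ≠ 0 := sub_ne_zero.2 fun h => hθ (Circle.ext h).symm
    have hker := kernel_identity (Circle.coe_ne_zero (Circle.exp θ)) (Circle.coe_ne_zero t) hne N
    have hVθ : V (Circle.exp θ) = ∑ k ∈ Finset.range N,
        (t : ℂ)⁻¹ * (t : ℂ)⁻¹ ^ (N - 1 - k) * (Circle.exp θ : ℂ) ^ (-(k : ℤ)) := by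
      rw [hV, ContinuousMap.sum_apply]
      exact Finset.sum_congr rfl fun k _ => by
        rw [ContinuousMap.smul_apply, zp_apply, smul_eq_mul]
    rw [ContinuousMap.mul_apply, hVθ, ← hker]
    simp only [weighted, ContinuousMap.add_apply, ContinuousMap.smul_apply, ContinuousMap.mul_apply,
      zp_apply, smul_eq_mul]
    ring
  simp only [hUt, sub_zero, zero_mul, add_zero] at hlim
  rw [hcongr, intervalIntegral.integral_const_mul, hint, mul_zero, mul_zero, hlin] at hlim
  linear_combination hlim

lemma hilbert_weighted_recurrence {C r : ℝ≥0} (hr : 0 < r) (hw : HolderWith C r w) {m : ℕ}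
    {f g h : C(Circle, ℂ)} {p q p' q' : ℤ} (hg : g ∈ laurent p q) (hh : h ∈ laurent p' q') (c d : ℂ)
    (hrec : zp (-1) * f = c • g - d • h)
    (horth : ∀ k : ℤ, -m ≤ k → k < m → Lam w (f * zp k) = 0) (θ : ℝ) :
    hilbert (weighted w (zp (-(m + 1)) * f)) (Circle.exp θ) =
      Complex.exp (-Complex.I * (2 * (((m : ℂ) + 1) - 1) * θ)) *
        (c * hilbert (weighted w (zp m * g)) (Circle.exp θ)
          - d * hilbert (weighted w (zp m * h)) (Circle.exp θ)) := by
  have hg' : zp m * g ∈ laurent (m + p) (m + q) := zp_mul_mem _ hg le_rfl le_rfl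
  have hh' : zp m * h ∈ laurent (m + p') (m + q') := zp_mul_mem _ hh le_rfl le_rfl
  -- The zero summand lets `hilbert_weighted_add_smul` also serve as homogeneity.
  have hcg : (0 : C(Circle, ℂ)) + c • (zp m * g) ∈ laurent (m + p) (m + q) := by
    rw [zero_add]
    exact Submodule.smul_mem _ _ hg'
  have hQeq : zp m * (zp (-1) * f) = (0 + c • (zp m * g)) + (-d) • (zp m * h) := by
    rw [hrec, mul_sub, mul_smul_comm, mul_smul_comm]
    module
  have hQmem : zp m * (zp (-1) * f) ∈ laurent (min (m + p) (m + p')) (max (m + q) (m + q')) := by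
    rw [hQeq]
    exact add_mem (laurent_mono (min_le_left _ _) (le_max_left _ _) hcg)
      (Submodule.smul_mem _ _ (laurent_mono (min_le_right _ _) (le_max_right _ _) hh'))
  -- For 0 ≤ k < 2m the exponent paired with f is m - 1 - k, which runs exactly through -m..m-1.
  have hmain := hilbert_weighted_zp_mul hr hw hQmem (2 * m) (fun k hk => by
    rw [← mul_assoc, zp_mul_zp, Lam_zp_mul_mul_zp]
    exact horth _ (by omega) (by omega)) (Circle.exp θ)
  have hzero : hilbert (weighted w (0 : C(Circle, ℂ))) (Circle.exp θ) = 0 := by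
    have := hilbert_weighted_add_smul hr hw (zero_mem (laurent 0 0)) (zero_mem (laurent 0 0)) 1
      (Circle.exp θ)
    rw [smul_zero, add_zero, one_mul] at this
    linear_combination -this
  have hshift : zp (-((2 * m : ℕ) : ℤ)) * (zp m * (zp (-1) * f)) = zp (-(m + 1)) * f := by
    rw [← mul_assoc, ← mul_assoc, zp_mul_zp, zp_mul_zp]
    congr 2
    push_cast
    ring
  rw [hshift, hQeq, hilbert_weighted_add_smul hr hw hcg hh',
    hilbert_weighted_add_smul hr hw (zero_mem (laurent 0 0)) hg', hzero, Circle.coe_exp,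
    ← Complex.exp_int_mul] at hmain
  rw [hmain]
  push_cast
  ring_nf

lemma IsWeight.zp_mul_eq_of_recurrence (hw : IsWeight w) {m n : ℕ} {f : C(Circle, ℂ)}
    {c d c₁ d₁ c₂ d₂ : ℂ} (h : zp (-1) * f = c • star (combC w n c₁ d₁) - d • star (combC w m c₂ d₂))
    (θ : ℝ) : Complex.exp (-Complex.I * θ) * f (Circle.exp θ) =
      c * comb w n (conj c₁) (conj d₁) (Circle.exp θ)
        - d * comb w m (conj c₂) (conj d₂) (Circle.exp θ) := by
  have hz : zp (-1) (Circle.exp θ) = Complex.exp (-Complex.I * θ) := by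
    rw [zp_apply, zpow_neg_one, Circle.coe_exp, ← Complex.exp_neg, neg_mul, mul_comm]
  have h' := congrArg (fun g : C(Circle, ℂ) => g (Circle.exp θ)) h
  simp only [star_combC, ContinuousMap.mul_apply, ContinuousMap.sub_apply,
    ContinuousMap.smul_apply, smul_eq_mul, hw.combC_apply, hz] at h'
  exact h'

end OTP

theorem theorem4p10 (w : Circle → ℝ)
    (hw_holder : ∃ (C r : ℝ≥0), 0 < r ∧ HolderWith C r w)
    (hw_nonneg : ∀ τ, 0 ≤ w τ)
    (hw_prob : (2 * Real.pi)⁻¹ * ∫ θ in (0 : ℝ)..(2 * Real.pi), w (Circle.exp θ) = 1)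
    (n : ℕ) (hn : 1 ≤ n) :
    -- The four-term recurrences.
    (∀ θ ∈ Set.Ico (0 : ℝ) (2 * Real.pi),
      (OTP.lam1 w n * Complex.exp (-Complex.I * θ) - conj (OTP.lam1 w n) * OTP.tri22 w n)
            * OTP.a w n * OTP.sigma w n (Circle.exp θ)
          + (OTP.lam2 w n * Complex.exp (-Complex.I * θ) - conj (OTP.lam2 w n) * OTP.tri22 w n)
            * OTP.b w n * OTP.ppi w n (Circle.exp θ)
        = -OTP.tri12 w n *
            (conj (OTP.lam3 w (n - 1)) * OTP.a w (n - 1) * OTP.sigma w (n - 1) (Circle.exp θ)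
              + conj (OTP.lam4 w (n - 1)) * OTP.b w (n - 1) * OTP.ppi w (n - 1) (Circle.exp θ))
      ∧
      (OTP.lam3 w (n - 1) * Complex.exp (-Complex.I * θ)
              + conj (OTP.lam3 w (n - 1)) * OTP.tri11 w n)
            * OTP.a w (n - 1) * OTP.sigma w (n - 1) (Circle.exp θ)
          + (OTP.lam4 w (n - 1) * Complex.exp (-Complex.I * θ)
              + conj (OTP.lam4 w (n - 1)) * OTP.tri11 w n)
            * OTP.b w (n - 1) * OTP.ppi w (n - 1) (Circle.exp θ)
        = OTP.tri21 w n *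
            (conj (OTP.lam1 w n) * OTP.a w n * OTP.sigma w n (Circle.exp θ)
              + conj (OTP.lam2 w n) * OTP.b w n * OTP.ppi w n (Circle.exp θ)))
    ∧
    -- The Hilbert transforms: existence of the principal values, and the two identities.
    (∀ F F' G G' : Circle → ℂ,
      (∀ τ, F τ = (τ : ℂ) ^ (-(n : ℤ)) *
        OTP.comb w n (OTP.lam1 w n) (OTP.lam2 w n) τ * w τ) →
      (∀ τ, F' τ = (τ : ℂ) ^ (n - 1) *
        OTP.comb w n (conj (OTP.lam1 w n)) (conj (OTP.lam2 w n)) τ * w τ) →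
      (∀ τ, G τ = (τ : ℂ) ^ (-(n : ℤ)) *
        OTP.comb w (n - 1) (OTP.lam3 w (n - 1)) (OTP.lam4 w (n - 1)) τ * w τ) →
      (∀ τ, G' τ = (τ : ℂ) ^ (n - 1) *
        OTP.comb w (n - 1) (conj (OTP.lam3 w (n - 1))) (conj (OTP.lam4 w (n - 1))) τ * w τ) →
      ∀ θ ∈ Set.Ico (0 : ℝ) (2 * Real.pi),
        (OTP.HilbertExists F (Circle.exp θ) ∧ OTP.HilbertExists F' (Circle.exp θ) ∧
          OTP.HilbertExists G (Circle.exp θ) ∧ OTP.HilbertExists G' (Circle.exp θ)) ∧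
        OTP.hilbert F (Circle.exp θ)
          = Complex.exp (-Complex.I * (2 * ((n : ℂ) - 1) * θ)) *
            (OTP.tri22 w n * OTP.hilbert F' (Circle.exp θ)
              - OTP.tri12 w n * OTP.hilbert G' (Circle.exp θ)) ∧
        OTP.hilbert G (Circle.exp θ)
          = Complex.exp (-Complex.I * (2 * ((n : ℂ) - 1) * θ)) *
            (OTP.tri21 w n * OTP.hilbert F' (Circle.exp θ)
              - OTP.tri11 w n * OTP.hilbert G' (Circle.exp θ))) := by
  obtain ⟨C, r, hr, hH⟩ := hw_holder
  -- A positive Hölder exponent gives continuity.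
  obtain ⟨w, rfl⟩ : ∃ W : C(Circle, ℝ), ⇑W = w := ⟨⟨w, hH.continuous hr⟩, rfl⟩
  have hw : OTP.IsWeight w := ⟨hw_nonneg, hw_prob⟩
  obtain ⟨m, rfl⟩ : ∃ m, n = m + 1 := ⟨n - 1, by omega⟩
  simp only [Nat.add_sub_cancel]
  refine ⟨fun θ _ => ⟨?_, ?_⟩, fun F F' G G' hF hF' hG hG' θ _ => ?_⟩
  · have h := hw.zp_mul_eq_of_recurrence (hw.zp_mul_oddCircle m) θ
    rw [OTP.oddCircle, hw.combC_apply] at h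
    simp only [OTP.comb] at h
    linear_combination h
  · have h := hw.zp_mul_eq_of_recurrence (hw.zp_mul_evenCircle m) θ
    rw [OTP.evenCircle, hw.combC_apply] at h
    simp only [OTP.comb] at h
    linear_combination h
  · have hE := OTP.oddCircle_mem w (m + 1)
    have hD := OTP.evenCircle_mem w m
    have hE' := OTP.star_mem_laurent hE le_rfl le_rfl
    have hD' := OTP.star_mem_laurent hD le_rfl le_rfl
    obtain rfl : F = OTP.weighted w (OTP.zp (-(m + 1)) * OTP.oddCircle w (m + 1)) := by
      funext τ
      rw [hF, OTP.weighted, ContinuousMap.mul_apply, OTP.zp_apply, OTP.oddCircle, hw.combC_apply]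
      push_cast
      rfl
    obtain rfl : F' = OTP.weighted w (OTP.zp m * star (OTP.oddCircle w (m + 1))) := by
      funext τ
      rw [hF', OTP.weighted, ContinuousMap.mul_apply, OTP.zp_apply, OTP.oddCircle,
        OTP.star_combC, hw.combC_apply, zpow_natCast]
    obtain rfl : G = OTP.weighted w (OTP.zp (-(m + 1)) * OTP.evenCircle w m) := by
      funext τ
      rw [hG, OTP.weighted, ContinuousMap.mul_apply, OTP.zp_apply, OTP.evenCircle, hw.combC_apply]
      push_cast
      rfl
    obtain rfl : G' = OTP.weighted w (OTP.zp m * star (OTP.evenCircle w m)) := by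
      funext τ
      rw [hG', OTP.weighted, ContinuousMap.mul_apply, OTP.zp_apply, OTP.evenCircle,
        OTP.star_combC, hw.combC_apply, zpow_natCast]
    refine ⟨⟨OTP.hilbertExists_weighted hr hH (OTP.zp_mul_mem _ hE le_rfl le_rfl) _,
      OTP.hilbertExists_weighted hr hH (OTP.zp_mul_mem _ hE' le_rfl le_rfl) _,
      OTP.hilbertExists_weighted hr hH (OTP.zp_mul_mem _ hD le_rfl le_rfl) _,
      OTP.hilbertExists_weighted hr hH (OTP.zp_mul_mem _ hD' le_rfl le_rfl) _⟩, ?_, ?_⟩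
    · rw [Nat.cast_add, Nat.cast_one]
      exact OTP.hilbert_weighted_recurrence hr hH hE' hD' _ _ (hw.zp_mul_oddCircle m)
        (fun k h1 h2 => hw.Lam_oddCircle_mul_zp m h1 h2.le) θ
    · rw [Nat.cast_add, Nat.cast_one]
      exact OTP.hilbert_weighted_recurrence hr hH hE' hD' _ _ (hw.zp_mul_evenCircle m)
        (fun k h1 h2 => hw.Lam_evenCircle_mul_zp_of_lt m h1 h2) θ
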